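/- Let $\lambda,\mu>0$, $0<a\le 1$, $b=1-a$. Let $\{t_k\}_{k\ge0}$ be the points of a Poisson point process of intensity $\lambda$ on $[0,\infty)$, and let $(a_k)_{k\ge 0}$ be i.i.d. marks, independent of $\{t_k\}$, with the geometric distribution $P\{a_k=n\}=ab^{n-1}$, $n\ge 1$. Put $A(t)=\sum_{k\ge0}a_k\mathbf 1\{t_k\le t\}$. Let $\Delta_0=0$ and let $\Delta_1,\Delta_2,\dots$ be independent exponential random variables with parameter $\mu$, the sequence $(\Delta_n)$ being independent of the process $A$. Put $\tau_n=\Delta_0+\dots+\Delta_n$ (so $\tau_0=0$), $\tau_{-1}=0$, $A_n=A(\tau_n)$, and, for $M\in\{0,1,2,\dots\}$, $$\nu=\inf\{n\ge 0: A_n>M\}.$$ Write $F(x,v)=\frac{bx+\lambda}{x+\lambda}v$ and $\gamma(v,0)=E\left[v^{A_1-A_0}\right]$. Let $v,\theta\in\mathbb C$ with $|v|\le 1$, $\operatorname{Re}\theta\ge 0$, $\theta\ne 0$. Then $\nu<\infty$ almost surely, the integral below converges absolutely, $$\gamma(v,0)=\frac{\mu}{\mu+\lambda}\,\frac{1-bv}{1-F(\mu,v)},$$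 and, empty sums being $0$, $$\begin{aligned} \int_0^\infty e^{-\theta t}&E\left[v^{A_\nu}\mathbf 1\{t<\tau_{\nu-1}\}\right]dt =\frac1\theta\Bigg\{\gamma(v,0)\frac{\mu+\lambda}{\lambda}\Big[v^{M}+(1-F(\mu,v))\sum_{j=0}^{M-1}v^j\Big]\\ &-\gamma(v,0)\frac{\mu+\theta+\lambda}{\theta+\lambda}\Big[F(\theta,v)^{M}+(1-F(\mu+\theta,v))\sum_{j=0}^{M-1}F(\theta,v)^j\Big]\\ &-\frac{\mu}{\lambda}\Big[\sum_{j=0}^{M}v^j\sum_{i=0}^{M-j}F(\mu,v)^i-(F(\mu,v)+bv)\sum_{j=0}^{M-1}v^j\sum_{i=0}^{M-1-j}F(\mu,v)^i+bvF(\mu,v)\sum_{j=0}^{M-2}v^j\sum_{i=0}^{M-2-j}F(\mu,v)^i\Big]\\ &+\frac{\mu}{\mu+\lambda}\,\frac{\mu+\theta+\lambda}{\theta+\lambda}\Big[\sum_{j=0}^{M}F(\theta,v)^j\sum_{i=0}^{M-j}F(\mu,v)^i-(F(\mu+\theta,v)+bv)\sum_{j=0}^{M-1}F(\theta,v)^j\sum_{i=0}^{M-1-j}F(\mu,v)^i\\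 &\qquad\qquad+bvF(\mu+\theta,v)\sum_{j=0}^{M-2}F(\theta,v)^j\sum_{i=0}^{M-2-j}F(\mu,v)^i\Big]\Bigg\}. \end{aligned}$$ -/

import Mathlib

open MeasureTheory ProbabilityTheory
open scoped NNReal ENNReal

namespace ObservedPoisson

noncomputable section

variable {Ω : Type*} [MeasurableSpace Ω]

/-- The number of indices `k` with `t k ω ∈ B`, i.e. the value at `B` of the counting measure
`∑ₖ ε_{t k ω}`. -/
def pointCount (t : ℕ → Ω → ℝ) (B : Set ℝ) (ω : Ω) : ℕ∞ :=
  {k : ℕ | t k ω ∈ B}.encard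

/-- The random points `t 0, t 1, …` of `[0, ∞)` form a Poisson point process of intensity `lam`:
the number of points in a Borel set `B` of finite length `|B|` is Poisson with parameter
`lam * |B|`, and the numbers of points in disjoint Borel sets are independent. The enumeration of
the points need not be increasing. -/
structure IsPoissonPoints (lam : ℝ) (t : ℕ → Ω → ℝ) (P : Measure Ω) : Prop where
  measurable : ∀ k, Measurable (t k)
  nonneg : ∀ k ω, 0 ≤ t k ω
  law : ∀ B : Set ℝ, MeasurableSet B → B ⊆ Set.Ici 0 → volume B ≠ ∞ →
    HasLaw (pointCount t B)
      ((poissonMeasure (lam * volume.real B).toNNReal).map (Nat.cast : ℕ → ℕ∞)) P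
  indep : ∀ (n : ℕ) (B : Fin n → Set ℝ), (∀ i, MeasurableSet (B i)) →
    (∀ i, B i ⊆ Set.Ici 0) → Pairwise (fun i j => Disjoint (B i) (B j)) →
    iIndepFun (fun i => pointCount t (B i)) P

/-- The marked process `A(s) = ∑ₖ aₖ ε_{tₖ}[0, s]`. For Poisson points, almost surely only
finitely many terms are nonzero for every `s`. -/
def markedProcess (t : ℕ → Ω → ℝ) (a : ℕ → Ω → ℕ) (s : ℝ) (ω : Ω) : ℕ :=
  ∑' k, if t k ω ∈ Set.Icc 0 s then a k ω else 0

/-- The observation times `τₙ = Δ₀ + Δ₁ + ⋯ + Δₙ`. -/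
def obsTime (Δ : ℕ → Ω → ℝ) (n : ℕ) (ω : Ω) : ℝ :=
  ∑ k ∈ Finset.range (n + 1), Δ k ω

/-- The time `τₙ₋₁` of the preceding observation, with `τ₋₁ = 0`. -/
def prevObsTime (Δ : ℕ → Ω → ℝ) (n : ℕ) (ω : Ω) : ℝ :=
  if n = 0 then 0 else obsTime Δ (n - 1) ω

/-- The observed value `Aₙ = A(τₙ)`. -/
def obsValue (t : ℕ → Ω → ℝ) (a : ℕ → Ω → ℕ) (Δ : ℕ → Ω → ℝ) (n : ℕ) (ω : Ω) : ℕ :=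
  markedProcess t a (obsTime Δ n ω) ω

/-- The exit index `ν = inf {n : Aₙ > M}`. -/
def exitIndex (t : ℕ → Ω → ℝ) (a : ℕ → Ω → ℕ) (Δ : ℕ → Ω → ℝ) (M : ℕ) (ω : Ω) : ℕ :=
  sInf {n : ℕ | M < obsValue t a Δ n ω}

/-- The random variable `v ^ A_ν * 1{s < τ_{ν-1}}`. -/
def exitVariable (t : ℕ → Ω → ℝ) (a : ℕ → Ω → ℕ) (Δ : ℕ → Ω → ℝ) (M : ℕ) (v : ℂ) (s : ℝ)
    (ω : Ω) : ℂ :=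
  if s < prevObsTime Δ (exitIndex t a Δ M ω) ω
    then v ^ obsValue t a Δ (exitIndex t a Δ M ω) ω else 0

/-- The joint transform `γ(z, θ) = E[z ^ X₁ * exp (-θ * Δ₁)]` of the increment `X₁ = A₁ - A₀`
and of `Δ₁`. Almost surely `A₀ ≤ A₁`, so that the subtraction is the genuine one. -/
def jointTransform (P : Measure Ω) (t : ℕ → Ω → ℝ) (a : ℕ → Ω → ℕ) (Δ : ℕ → Ω → ℝ)
    (z θ : ℂ) : ℂ :=
  ∫ ω, z ^ (obsValue t a Δ 1 ω - obsValue t a Δ 0 ω) * Complex.exp (-θ * (Δ 1 ω : ℂ)) ∂P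

/-- `F(x, v) = (b x + λ) v / (x + λ)`. -/
def transformF (b lam : ℝ) (x v : ℂ) : ℂ :=
  ((b : ℂ) * x + (lam : ℂ)) / (x + (lam : ℂ)) * v

end

end ObservedPoisson

/-! Write X_{m+1} = A_{m+1} - A_m. Almost surely A_n is nondecreasing with A_0 = 0, so ν = m + 1
exactly when A_m ≤ M < A_m + X_{m+1}. The exit variable is thus the sum over m of v^{A_{m+1}} 1{A_m
≤ M < A_{m+1}} 1{s < τ_m}. Integrating e^{-θs} over [0, τ_m) gives (1 - e^{-θτ_m})/θ, so the
integral is (G(0) - G(θ))/θ with G(θ) = Σ_m E[v^{A_{m+1}} e^{-θτ_m}; A_m ≤ M < A_{m+1}]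
(`integral_exp_mul_integral`).

To find G, drop the event and mark A_m by z and X_{m+1} by w. Given the gaps, A is compound Poisson
with exponent κ(z) = λ(1 - g(z)), g being the generating function of a mark. Hence E[z^{A_m}
w^{X_{m+1}} e^{-θτ_m}] = (μ/(μ+θ+κ(z)))^m · μ/(μ+κ(w)) (`integral_exp_mul_pow`). For geometric marks
κ is a Möbius function, so the sum over m is a Möbius function of z times one of w
(`integral_occupation`).

Both have explicit Taylor coefficients, and the crossing event is the disjoint union over k ≤ M of
{A_m = k, X_{m+1} > M - k}. This makes G a finite sum (`setIntegral_crossing`), rearranged in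
`sum_crossing_eq`. The sum over m and the expectation are handled together as one integral against
`occupation P`; this measure is infinite, which is why z stays in the open disc. -/

namespace ObservedPoisson

open Filter Topology Finset

/-! ### Transforms of the geometric, Poisson and exponential laws. -/

section Distributions

variable {Ω : Type*} [MeasurableSpace Ω] {P : Measure Ω}

/-- The generating function of the geometric distribution on `{1, 2, …}`. -/
noncomputable def geomGF (p : ℝ) (z : ℂ) : ℂ := p * z / (1 - (1 - p : ℝ) * z)

lemma one_sub_mul_ne_zero {q : ℝ} (hq0 : 0 ≤ q) (hq1 : q < 1) {z : ℂ} (hz : ‖z‖ ≤ 1) :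
    (1 : ℂ) - q * z ≠ 0 := by
  intro h
  have h1 : ‖(q : ℂ) * z‖ = 1 := by rw [← sub_eq_zero.1 h]; simp
  rw [norm_mul, Complex.norm_real, Real.norm_of_nonneg hq0] at h1
  nlinarith [norm_nonneg z]

/-- The bound by ‖z‖ rather than by 1 is what gives `markedExponent` a positive real part in the
open disc. -/
lemma norm_geomGF_le {p : ℝ} (hp : 0 < p) (hp1 : p ≤ 1) {z : ℂ} (hz : ‖z‖ ≤ 1) :
    ‖geomGF p z‖ ≤ ‖z‖ := by
  have h : p ≤ ‖(1 : ℂ) - (1 - p : ℝ) * z‖ := by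
    have h1 := norm_sub_norm_le (1 : ℂ) ((1 - p : ℝ) * z)
    rw [norm_mul, Complex.norm_real, Real.norm_of_nonneg (by linarith), norm_one] at h1
    nlinarith [norm_nonneg z]
  rw [geomGF, norm_div, norm_mul, Complex.norm_real, Real.norm_of_nonneg hp.le]
  rw [div_le_iff₀ (hp.trans_le h), mul_comm]
  exact mul_le_mul_of_nonneg_left h (norm_nonneg z)

lemma integral_pow_of_geometric {p : unitInterval} (hp : 0 < p) {X : Ω → ℕ}
    (hX : HasLaw X ((geometricMeasure p).map (fun n => n + 1)) P) {z : ℂ} (hz : ‖z‖ ≤ 1) :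
    ∫ ω, z ^ X ω ∂P = geomGF p z := by
  have h0 : ∫ ω, z ^ X ω ∂P = ∫ n, z ^ n ∂((geometricMeasure p).map (fun n => n + 1)) :=
    hX.integral_comp (f := fun n : ℕ => z ^ n) .of_discrete
  have hp' : (0 : ℝ) < p := hp
  have hp1 : (p : ℝ) ≤ 1 := p.2.2
  rw [h0, integral_map .of_discrete .of_discrete, integral_geometricMeasure hp.ne']
  have hn : ‖((1 - p : ℝ) : ℂ) * z‖ < 1 := by
    rw [norm_mul, Complex.norm_real, Real.norm_of_nonneg (by linarith)]
    nlinarith [norm_nonneg z]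
  have := (hasSum_geometric_of_norm_lt_one hn).mul_left ((p : ℂ) * z)
  rw [geomGF, div_eq_mul_inv, ← this.tsum_eq]
  congr 1 with n
  rw [Complex.real_smul, mul_pow]
  push_cast
  ring

lemma integral_pow_of_poisson {r : ℝ≥0} {N : Ω → ℕ∞}
    (hN : HasLaw N ((poissonMeasure r).map (Nat.cast : ℕ → ℕ∞)) P) (z : ℂ) :
    ∫ ω, z ^ (N ω).toNat ∂P = Complex.exp (r * (z - 1)) := by
  have h0 : ∫ ω, z ^ (N ω).toNat ∂P
      = ∫ n, z ^ n.toNat ∂((poissonMeasure r).map (Nat.cast : ℕ → ℕ∞)) :=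
    hN.integral_comp (f := fun n : ℕ∞ => z ^ n.toNat) .of_discrete
  rw [h0, integral_map .of_discrete .of_discrete, integral_poissonMeasure]
  have h := (NormedSpace.expSeries_div_hasSum_exp ((r : ℂ) * z)).mul_left (Complex.exp (-r))
  rw [← Complex.exp_eq_exp_ℂ, ← Complex.exp_add] at h
  rw [show (r : ℂ) * (z - 1) = -r + r * z by ring, ← h.tsum_eq]
  congr 1 with n
  rw [Complex.real_smul, ENat.toNat_natCast, mul_pow]
  push_cast
  ring

lemma ae_ne_top_of_poisson {r : ℝ≥0} {N : Ω → ℕ∞}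
    (hN : HasLaw N ((poissonMeasure r).map (Nat.cast : ℕ → ℕ∞)) P) : ∀ᵐ ω ∂P, N ω ≠ ⊤ := by
  refine (hN.ae_iff (p := fun n => n ≠ ⊤) .of_discrete).2 ?_
  rw [ae_map_iff .of_discrete .of_discrete]
  simp

lemma expMeasure_eq_withDensity (mu : ℝ) :
    expMeasure mu = (volume.restrict (Set.Ioi 0)).withDensity
      (fun x => ENNReal.ofReal (mu * Real.exp (-(mu * x)))) := by
  rw [← withDensity_indicator measurableSet_Ioi]
  refine withDensity_congr_ae ?_
  filter_upwards [Measure.ae_ne volume (0 : ℝ)] with x hx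
  rcases hx.lt_or_gt with h | h
  · rw [Set.indicator_of_notMem (by simpa using h.le)]
    exact exponentialPDF_of_neg h
  · rw [Set.indicator_of_mem (by simpa using h)]
    exact exponentialPDF_of_nonneg h.le

lemma integral_of_exponential {mu : ℝ} (hmu : 0 < mu) (f : ℝ → ℂ) :
    ∫ x, f x ∂(expMeasure mu) = ∫ x in Set.Ioi (0 : ℝ), (mu * Real.exp (-(mu * x)) : ℝ) * f x := by
  rw [expMeasure_eq_withDensity, integral_withDensity_eq_integral_toReal_smul
    (by fun_prop) (.of_forall fun _ => ENNReal.ofReal_lt_top)]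
  congr 1 with x
  rw [ENNReal.toReal_ofReal (by positivity), Complex.real_smul]

lemma ae_nonneg_of_exponential (mu : ℝ) : ∀ᵐ x ∂(expMeasure mu), 0 ≤ x := by
  rw [expMeasure_eq_withDensity]
  refine (withDensity_absolutelyContinuous _ _).ae_le ?_
  filter_upwards [ae_restrict_mem measurableSet_Ioi] with x hx using le_of_lt hx

lemma integrable_id_exponential {mu : ℝ} (hmu : 0 < mu) :
    Integrable (fun x : ℝ => x) (expMeasure mu) := by
  rw [expMeasure_eq_withDensity,
    integrable_withDensity_iff (by fun_prop) (.of_forall fun _ => ENNReal.ofReal_lt_top)]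
  have h := (integrableOn_rpow_mul_exp_neg_mul_rpow (s := 1) (p := 1) (by norm_num) one_pos hmu)
  refine (h.const_mul mu).congr (.of_forall fun x => ?_)
  simp only [Real.rpow_one]
  rw [ENNReal.toReal_ofReal (by positivity)]
  ring_nf

lemma integral_exp_exponential {mu : ℝ} (hmu : 0 < mu) {s : ℂ} (hs : 0 ≤ s.re) :
    ∫ x : ℝ, Complex.exp (-s * x) ∂(expMeasure mu) = mu / (mu + s) := by
  rw [integral_of_exponential hmu]
  have h : ∀ x : ℝ, ((mu * Real.exp (-(mu * x)) : ℝ) : ℂ) * Complex.exp (-s * x)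
      = mu * Complex.exp (-(mu + s) * x) := fun x => by
    push_cast
    rw [mul_assoc, ← Complex.exp_add]
    ring_nf
  simp_rw [h]
  have hre : 0 < (mu + s).re := by simp; linarith
  have hne : (mu : ℂ) + s ≠ 0 := fun h => by simp [h] at hre
  rw [integral_const_mul, integral_exp_mul_complex_Ioi (by simp at hre ⊢; linarith)]
  simp only [Complex.ofReal_zero, mul_zero, Complex.exp_zero]
  field_simp

end Distributions

/-- Used with X the points or the gaps, which are frozen while the inner expectation runs over Y. -/
lemma integral_indepFun_eq_integral_integral {Ω α β : Type*} [MeasurableSpace Ω]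
    [MeasurableSpace α] [MeasurableSpace β] {P : Measure Ω} [IsProbabilityMeasure P]
    {X : Ω → α} {Y : Ω → β} (hXY : IndepFun X Y P) (hX : Measurable X) (hY : Measurable Y)
    {H : α × β → ℂ} (hH : Measurable H) (hint : Integrable (fun ω => H (X ω, Y ω)) P) :
    ∫ ω, H (X ω, Y ω) ∂P = ∫ ω, ∫ ω', H (X ω, Y ω') ∂P ∂P := by
  have hmap := (indepFun_iff_map_prod_eq_prod_map_map hX.aemeasurable hY.aemeasurable).1 hXY
  have := Measure.isProbabilityMeasure_map hX.aemeasurable (μ := P)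
  have := Measure.isProbabilityMeasure_map hY.aemeasurable (μ := P)
  have hi : Integrable H ((P.map X).prod (P.map Y)) := by
    rw [← hmap, integrable_map_measure hH.aestronglyMeasurable (hX.prodMk hY).aemeasurable]
    exact hint
  have h1 : ∫ ω, H (X ω, Y ω) ∂P = ∫ q, H q ∂((P.map X).prod (P.map Y)) := by
    rw [← hmap, integral_map (hX.prodMk hY).aemeasurable hH.aestronglyMeasurable]
  rw [h1, integral_prod _ hi, integral_map hX.aemeasurable
    hH.stronglyMeasurable.integral_prod_right'.aestronglyMeasurable]
  congr 1 with ω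
  exact integral_map hY.aemeasurable (hH.comp measurable_prodMk_left).aestronglyMeasurable

/-! ### Uniqueness of power series coefficients; truncated sums of coefficients of Möbius functions.
-/

section PowerSeries

/-- Summability at every point of the open disc forces radius of convergence at least 1, and a power
series representing the zero function vanishes. -/
lemma eq_zero_of_hasSum_pow_mul_zero {a : ℕ → ℂ}
    (h : ∀ z : ℂ, ‖z‖ < 1 → HasSum (fun k => z ^ k * a k) 0) (k : ℕ) : a k = 0 := by
  have hp : HasFPowerSeriesOnBall (fun _ : ℂ => (0 : ℂ))
      (FormalMultilinearSeries.ofScalars ℂ a) 0 1 := by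
    refine ⟨?_, one_pos, fun {y} hy => ?_⟩
    · refine ENNReal.le_of_forall_nnreal_lt fun r hr => ?_
      refine FormalMultilinearSeries.le_radius_of_summable _ ?_
      have hr' : ‖((r : ℝ) : ℂ)‖ < 1 := by simpa using hr
      refine ((h _ hr').summable.norm).congr fun n => ?_
      simp [mul_comm]
    · simp only [FormalMultilinearSeries.ofScalars_apply_eq]
      have hy' : ‖y‖ < 1 := by
        rw [← coe_nnnorm]
        simpa [edist_zero_right, enorm_eq_nnnorm, -coe_nnnorm] using hy
      simpa [mul_comm, smul_eq_mul] using h y hy'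
  have h0 := hp.hasFPowerSeriesAt.eq_zero
  have h1 := congrArg (fun q => q.coeff k) h0
  rw [FormalMultilinearSeries.coeff_ofScalars] at h1
  exact h1

lemma eq_of_hasSum_pow_mul {a b : ℕ → ℂ} {s : ℂ → ℂ}
    (ha : ∀ z : ℂ, ‖z‖ < 1 → HasSum (fun k => z ^ k * a k) (s z))
    (hb : ∀ z : ℂ, ‖z‖ < 1 → HasSum (fun k => z ^ k * b k) (s z)) (k : ℕ) : a k = b k := by
  refine sub_eq_zero.1 (eq_zero_of_hasSum_pow_mul_zero (a := fun k => a k - b k)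
    (fun z hz => ?_) k)
  simpa [mul_sub] using (ha z hz).sub (hb z hz)

/-- The coefficients of `(1 - y z) / (1 - x z)`. -/
def ratioCoeff (x y : ℂ) : ℕ → ℂ
  | 0 => 1
  | k + 1 => x ^ (k + 1) - y * x ^ k

lemma hasSum_ratioCoeff (x y : ℂ) {z : ℂ} (hz : ‖x * z‖ < 1) :
    HasSum (fun k => z ^ k * ratioCoeff x y k) ((1 - y * z) / (1 - x * z)) := by
  have h := hasSum_geometric_of_norm_lt_one hz
  have hne : 1 - x * z ≠ 0 := fun h => by
    rw [sub_eq_zero] at h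
    simp [← h] at hz
  rw [← hasSum_nat_add_iff' 1]
  convert! h.mul_left ((x - y) * z) using 1
  · ext k
    simp only [ratioCoeff]
    ring
  · simp only [range_one, sum_singleton, ratioCoeff]
    rw [pow_zero, one_mul, div_sub_one hne, div_eq_mul_inv]
    ring

/-- For j ≥ 1 the coefficient is x^j - y x^(j-1), and the second piece reproduces the first sum with
N lowered by one. For N = 0 truncated subtraction leaves every sum empty. -/
lemma sum_mul_ratioCoeff (x y v : ℂ) (β : ℕ → ℂ) (N : ℕ) :
    ∑ j ∈ range N, v ^ j * ratioCoeff x y j * ∑ i ∈ range (N - j), β i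
      = ∑ j ∈ range N, (v * x) ^ j * ∑ i ∈ range (N - j), β i
        - v * y * ∑ j ∈ range (N - 1), (v * x) ^ j * ∑ i ∈ range (N - 1 - j), β i := by
  cases N with
  | zero => simp
  | succ N =>
    rw [sum_range_succ', sum_range_succ', Nat.add_sub_cancel, mul_sum (range N) _ (v * y), add_sub_right_comm,
      ← sum_sub_distrib]
    congr 1
    · refine sum_congr rfl fun j _ => ?_
      rw [Nat.add_sub_add_right, ratioCoeff]
      ring
    · simp [ratioCoeff]

lemma sum_range_ratioCoeff (x y v : ℂ) (n : ℕ) :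
    ∑ i ∈ range n, v ^ i * ratioCoeff x y i
      = ∑ i ∈ range n, (v * x) ^ i - v * y * ∑ i ∈ range (n - 1), (v * x) ^ i := by
  cases n with
  | zero => simp
  | succ n =>
    rw [sum_range_succ', sum_range_succ', Nat.add_sub_cancel, mul_sum (range n) _ (v * y), add_sub_right_comm,
      ← sum_sub_distrib]
    congr 1
    · refine sum_congr rfl fun j _ => ?_
      rw [ratioCoeff]
      ring
    · simp [ratioCoeff]

lemma sum_pow_mul_shift (x u : ℂ) (N : ℕ) :
    ∑ j ∈ range N, x ^ j * ∑ i ∈ range (N - j - 1), u ^ i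
      = ∑ j ∈ range (N - 1), x ^ j * ∑ i ∈ range (N - 1 - j), u ^ i := by
  cases N with
  | zero => simp
  | succ N =>
    rw [sum_range_succ]
    simp only [Nat.add_sub_cancel_left, Nat.sub_self, range_zero, sum_empty, mul_zero, add_zero,
      Nat.add_sub_cancel]
    refine sum_congr rfl fun j _ => ?_
    rw [show N + 1 - j - 1 = N - j by omega]

/-- With S the operator lowering N by one, the two numerators act as (1 - vyS)(1 - vbS), whence the
three sums at N, N - 1, N - 2. -/
lemma sum_mul_sum_ratioCoeff (x y u b v : ℂ) (N : ℕ) :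
    ∑ j ∈ range N, v ^ j * ratioCoeff x y j * ∑ i ∈ range (N - j), v ^ i * ratioCoeff u b i
      = ∑ j ∈ range N, (v * x) ^ j * ∑ i ∈ range (N - j), (v * u) ^ i
        - (v * y + v * b) *
          ∑ j ∈ range (N - 1), (v * x) ^ j * ∑ i ∈ range (N - 1 - j), (v * u) ^ i
        + v * b * (v * y) *
          ∑ j ∈ range (N - 2), (v * x) ^ j * ∑ i ∈ range (N - 2 - j), (v * u) ^ i := by
  have h : ∀ n, ∑ j ∈ range n, (v * x) ^ j * ∑ i ∈ range (n - j), v ^ i * ratioCoeff u b i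
      = ∑ j ∈ range n, (v * x) ^ j * ∑ i ∈ range (n - j), (v * u) ^ i
        - v * b * ∑ j ∈ range (n - 1), (v * x) ^ j * ∑ i ∈ range (n - 1 - j), (v * u) ^ i := by
    intro n
    simp_rw [sum_range_ratioCoeff, mul_sub, sum_sub_distrib]
    rw [← sum_pow_mul_shift, mul_sum]
    congr 1
    exact sum_congr rfl fun j _ => by ring
  rw [sum_mul_ratioCoeff, h, h, show N - 1 - 1 = N - 2 by omega]
  ring

end PowerSeries

/-! ### Measurability of sums of marks. -/

section MarkSum

/-- The sum of the marks `α k` of the points `x k` lying in `B`. -/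
noncomputable def markSum (B : Set ℝ) (α : ℕ → ℕ) (x : ℕ → ℝ) : ℕ :=
  open Classical in ∑' k, if x k ∈ B then α k else 0

/-- The default values agree: a divergent series is 0 in ℕ, and `toNNReal` sends ⊤ to 0. The
right-hand side is a composition of measurable maps. -/
lemma tsum_nat_eq_floor (f : ℕ → ℕ) :
    ∑' k, f k = ⌊(∑' k, (f k : ℝ≥0∞)).toNNReal⌋₊ := by
  by_cases h : Summable f
  · have h1 : HasSum (fun k => (f k : ℝ≥0∞)) ((∑' k, f k : ℕ) : ℝ≥0∞) :=
      h.hasSum.map (Nat.castAddMonoidHom ℝ≥0∞) continuous_of_discreteTopology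
    rw [h1.tsum_eq]
    simp
  · have h1 : ∑' k, (f k : ℝ≥0∞) = ⊤ := by
      by_contra hne
      refine h (summable_of_hasFiniteSupport ?_)
      refine (ENNReal.finite_const_le_of_tsum_ne_top hne one_ne_zero).subset fun k hk => ?_
      simpa [Nat.one_le_iff_ne_zero] using hk
    rw [tsum_eq_zero_of_not_summable h, h1]
    simp

lemma measurable_tsum_nat {α : Type*} [MeasurableSpace α] {f : ℕ → α → ℕ}
    (hf : ∀ k, Measurable (f k)) : Measurable fun x => ∑' k, f k x := by
  simp_rw [tsum_nat_eq_floor]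
  refine Nat.measurable_floor.comp (ENNReal.measurable_toNNReal.comp ?_)
  exact Measurable.tsum fun k => measurable_from_top.comp (hf k)

lemma measurable_markSum {B : Set ℝ} (hB : MeasurableSet B) :
    Measurable fun q : (ℕ → ℕ) × (ℕ → ℝ) => markSum B q.1 q.2 := by
  classical
  unfold markSum
  refine measurable_tsum_nat fun k => Measurable.ite ?_ ?_ measurable_const
  · exact ((measurable_pi_apply k).comp measurable_snd) hB
  · exact (measurable_pi_apply k).comp measurable_fst

lemma markSum_eq_sum {B : Set ℝ} {x : ℕ → ℝ} (K : Finset ℕ) (hK : ∀ k, k ∈ K ↔ x k ∈ B)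
    (α : ℕ → ℕ) : markSum B α x = ∑ k ∈ K, α k := by
  classical
  rw [markSum, tsum_eq_sum (s := K) (fun k hk => if_neg (mt (hK k).2 hk))]
  exact sum_congr rfl fun k hk => if_pos ((hK k).1 hk)

end MarkSum

/-! ### Generating functions of marked Poisson points. -/

section MarkedPoisson

variable {Ω : Type*} [MeasurableSpace Ω] {P : Measure Ω}

lemma integral_prod_pow_marks {p : unitInterval} (hp : 0 < p) {a : ℕ → Ω → ℕ}
    (ha : ∀ k, Measurable (a k))
    (ha_law : ∀ k, HasLaw (a k) ((geometricMeasure p).map (fun n => n + 1)) P)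
    (ha_indep : iIndepFun a P) (S : Finset ℕ) {ζ : ℕ → ℂ} (hζ : ∀ k, ‖ζ k‖ ≤ 1) :
    ∫ ω, ∏ k ∈ S, ζ k ^ a k ω ∂P = ∏ k ∈ S, geomGF p (ζ k) := by
  have h := (ha_indep.precomp (g := ((↑) : S → ℕ)) Subtype.val_injective).integral_fun_prod_comp
    (f := fun (k : S) (n : ℕ) => ζ k ^ n) (fun k => (ha k).aemeasurable)
    (fun k => .of_discrete)
  simp_rw [integral_pow_of_geometric hp (ha_law _) (hζ _)] at h
  rw [Finset.prod_coe_sort S (fun k => geomGF p (ζ k))] at h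
  rw [← h]
  congr 1 with ω
  exact (Finset.prod_coe_sort S (fun k => ζ k ^ a k ω)).symm

lemma integral_pow_markSum {p : unitInterval} (hp : 0 < p) {a : ℕ → Ω → ℕ}
    (ha : ∀ k, Measurable (a k))
    (ha_law : ∀ k, HasLaw (a k) ((geometricMeasure p).map (fun n => n + 1)) P)
    (ha_indep : iIndepFun a P) {x : ℕ → ℝ} {B C : Set ℝ} (hBC : Disjoint B C)
    (hB : {k | x k ∈ B}.Finite) (hC : {k | x k ∈ C}.Finite) {z w : ℂ} (hz : ‖z‖ ≤ 1)
    (hw : ‖w‖ ≤ 1) :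
    ∫ ω, z ^ markSum B (fun k => a k ω) x * w ^ markSum C (fun k => a k ω) x ∂P
      = geomGF p z ^ {k | x k ∈ B}.encard.toNat * geomGF p w ^ {k | x k ∈ C}.encard.toNat := by
  classical
  have hB' : ∀ k, k ∈ hB.toFinset ↔ x k ∈ B := by simp
  have hC' : ∀ k, k ∈ hC.toFinset ↔ x k ∈ C := by simp
  have hdis : Disjoint hB.toFinset hC.toFinset := by
    rw [Finset.disjoint_left]
    exact fun k h1 h2 => Set.disjoint_left.1 hBC ((hB' k).1 h1) ((hC' k).1 h2)
  have hnB : ∀ k ∈ hC.toFinset, x k ∉ B := fun k hk h =>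
    Set.disjoint_left.1 hBC h ((hC' k).1 hk)
  -- Weight z for indices of points in B and w for those in C; disjointness of B and C separates the
  -- two products.
  have h := integral_prod_pow_marks hp ha ha_law ha_indep (hB.toFinset ∪ hC.toFinset)
    (ζ := fun k => if x k ∈ B then z else w) (fun k => by split_ifs <;> assumption)
  simp_rw [prod_union hdis] at h
  have e1 : ∀ f : ℂ → ℕ → ℂ, ∏ k ∈ hB.toFinset, f (if x k ∈ B then z else w) k
      = ∏ k ∈ hB.toFinset, f z k :=
    fun f => prod_congr rfl fun k hk => by rw [if_pos ((hB' k).1 hk)]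
  have e2 : ∀ f : ℂ → ℕ → ℂ, ∏ k ∈ hC.toFinset, f (if x k ∈ B then z else w) k
      = ∏ k ∈ hC.toFinset, f w k :=
    fun f => prod_congr rfl fun k hk => by rw [if_neg (hnB k hk)]
  rw [e1 (fun c _ => geomGF p c), e2 (fun c _ => geomGF p c), prod_const, prod_const] at h
  rw [hB.encard_eq_coe_toFinset_card, hC.encard_eq_coe_toFinset_card, ENat.toNat_natCast,
    ENat.toNat_natCast, ← h]
  congr 1 with ω
  rw [e1 (fun c k => c ^ a k ω), e2 (fun c k => c ^ a k ω), prod_pow_eq_pow_sum,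
    prod_pow_eq_pow_sum, markSum_eq_sum _ hB', markSum_eq_sum _ hC']

lemma norm_pow_mul_pow_le_one {z w : ℂ} (hz : ‖z‖ ≤ 1) (hw : ‖w‖ ≤ 1) (m n : ℕ) :
    ‖z ^ m * w ^ n‖ ≤ 1 := by
  rw [norm_mul, norm_pow, norm_pow]
  exact mul_le_one₀ (pow_le_one₀ (norm_nonneg _) hz) (by positivity)
    (pow_le_one₀ (norm_nonneg _) hw)

variable {lam : ℝ} {p : unitInterval} {t : ℕ → Ω → ℝ} {a : ℕ → Ω → ℕ}

lemma IsPoissonPoints.ae_finite (ht : IsPoissonPoints lam t P) {B : Set ℝ}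
    (hB : MeasurableSet B) (hB0 : B ⊆ Set.Ici 0) (hBv : volume B ≠ ∞) :
    ∀ᵐ ω ∂P, {k | t k ω ∈ B}.Finite := by
  filter_upwards [ae_ne_top_of_poisson (ht.law B hB hB0 hBv)] with ω hω
  exact Set.encard_ne_top_iff.1 hω

lemma IsPoissonPoints.integral_pow (hlam : 0 < lam) (ht : IsPoissonPoints lam t P) {B : Set ℝ}
    (hB : MeasurableSet B) (hB0 : B ⊆ Set.Ici 0) (hBv : volume B ≠ ∞) (z : ℂ) :
    ∫ ω, z ^ (pointCount t B ω).toNat ∂P = Complex.exp (-(lam * (1 - z)) * volume.real B) := by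
  rw [integral_pow_of_poisson (ht.law B hB hB0 hBv)]
  congr 1
  rw [Real.coe_toNNReal _ (by positivity)]
  push_cast
  ring

/-- The joint generating function of the total marks of two disjoint sets. -/
lemma IsPoissonPoints.integral_pow_markSum [IsProbabilityMeasure P] (hlam : 0 < lam) (ht : IsPoissonPoints lam t P)
    (hp : 0 < p) (ha : ∀ k, Measurable (a k))
    (ha_law : ∀ k, HasLaw (a k) ((geometricMeasure p).map (fun n => n + 1)) P)
    (ha_indep : iIndepFun a P) (hat : IndepFun (fun ω k => a k ω) (fun ω k => t k ω) P)
    {B C : Set ℝ} (hBC : Disjoint B C) (hB : MeasurableSet B) (hC : MeasurableSet C)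
    (hB0 : B ⊆ Set.Ici 0) (hC0 : C ⊆ Set.Ici 0) (hBv : volume B ≠ ∞) (hCv : volume C ≠ ∞)
    {z w : ℂ} (hz : ‖z‖ ≤ 1) (hw : ‖w‖ ≤ 1) :
    ∫ ω, z ^ markSum B (fun k => a k ω) (fun k => t k ω)
        * w ^ markSum C (fun k => a k ω) (fun k => t k ω) ∂P
      = Complex.exp (-(lam * (1 - geomGF p z)) * volume.real B)
        * Complex.exp (-(lam * (1 - geomGF p w)) * volume.real C) := by
  have hH : Measurable fun q : (ℕ → ℝ) × (ℕ → ℕ) =>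
      z ^ markSum B q.2 q.1 * w ^ markSum C q.2 q.1 :=
    (measurable_from_top.comp ((measurable_markSum hB).comp measurable_swap)).mul
      (measurable_from_top.comp ((measurable_markSum hC).comp measurable_swap))
  have hta : Measurable fun ω k => t k ω := measurable_pi_lambda _ ht.measurable
  have haa : Measurable fun ω k => a k ω := measurable_pi_lambda _ ha
  rw [integral_indepFun_eq_integral_integral hat.symm hta haa hH (Integrable.of_bound
    (hH.comp (hta.prodMk haa)).aestronglyMeasurable 1
    (.of_forall fun ω => norm_pow_mul_pow_le_one hz hw _ _))]
  have h1 : ∀ᵐ ω ∂P, ∫ ω', z ^ markSum B (fun k => a k ω') (fun k => t k ω)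
        * w ^ markSum C (fun k => a k ω') (fun k => t k ω) ∂P
      = geomGF p z ^ (pointCount t B ω).toNat * geomGF p w ^ (pointCount t C ω).toNat := by
    filter_upwards [ht.ae_finite hB hB0 hBv, ht.ae_finite hC hC0 hCv] with ω h1 h2
    exact ObservedPoisson.integral_pow_markSum hp ha ha_law ha_indep hBC h1 h2 hz hw
  rw [integral_congr_ae h1]
  have hind : IndepFun (pointCount t B) (pointCount t C) P := by
    have := ht.indep 2 ![B, C] (by simp [Fin.forall_fin_two, hB, hC])
      (by simp [Fin.forall_fin_two, hB0, hC0])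
      (by
        intro i j hij
        fin_cases i <;> fin_cases j <;> simp_all [hBC.symm])
    simpa using this.indepFun (i := 0) (j := 1) (by simp)
  rw [hind.integral_fun_comp_mul_comp (f := fun n : ℕ∞ => geomGF p z ^ n.toNat)
    (g := fun n : ℕ∞ => geomGF p w ^ n.toNat) (ht.law B hB hB0 hBv).aemeasurable
    (ht.law C hC hC0 hCv).aemeasurable .of_discrete .of_discrete,
    ht.integral_pow hlam hB hB0 hBv, ht.integral_pow hlam hC hC0 hCv]

end MarkedPoisson

/-! ### Right-continuity of the path and its evaluation at random times. -/

section MarkedPath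

variable {Ω : Type*} {t : ℕ → Ω → ℝ} {a : ℕ → Ω → ℕ} {ω : Ω}

lemma markedProcess_eq_markSum (s : ℝ) (ω : Ω) :
    markedProcess t a s ω = markSum (Set.Icc 0 s) (fun k => a k ω) (fun k => t k ω) := by
  simp only [markedProcess, markSum]

lemma finite_mem_Icc (hω : ∀ n : ℕ, {k | t k ω ∈ Set.Icc (0 : ℝ) n}.Finite) (s : ℝ) :
    {k | t k ω ∈ Set.Icc 0 s}.Finite := by
  obtain ⟨n, hn⟩ := exists_nat_ge s
  exact (hω n).subset fun k hk => ⟨hk.1, hk.2.trans hn⟩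

lemma markedProcess_add_markSum (hω : ∀ n : ℕ, {k | t k ω ∈ Set.Icc (0 : ℝ) n}.Finite)
    {s s' : ℝ} (hs : 0 ≤ s) (hs' : s ≤ s') :
    markedProcess t a s' ω = markedProcess t a s ω
      + markSum (Set.Ioc s s') (fun k => a k ω) (fun k => t k ω) := by
  have hf := finite_mem_Icc hω s
  have hf' : {k | t k ω ∈ Set.Ioc s s'}.Finite :=
    (finite_mem_Icc hω s').subset fun k hk => ⟨hs.trans hk.1.le, hk.2⟩
  have hdis : Disjoint hf.toFinset hf'.toFinset := by
    rw [Finset.disjoint_left]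
    intro k h1 h2
    simp only [Set.Finite.mem_toFinset, Set.mem_ofPred_eq, Set.mem_Icc, Set.mem_Ioc] at h1 h2
    linarith
  rw [markedProcess_eq_markSum, markedProcess_eq_markSum,
    markSum_eq_sum (B := Set.Icc 0 s) hf.toFinset (by simp),
    markSum_eq_sum (B := Set.Ioc s s') hf'.toFinset (by simp),
    ← sum_union hdis]
  refine markSum_eq_sum _ (fun k => ?_) _
  rw [← Set.Icc_union_Ioc_eq_Icc hs hs']
  simp

lemma markedProcess_mono (hω : ∀ n : ℕ, {k | t k ω ∈ Set.Icc (0 : ℝ) n}.Finite) :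
    Monotone fun s => markedProcess t a s ω := by
  intro s s' h
  have hf := finite_mem_Icc hω s
  have hf' := finite_mem_Icc hω s'
  simp only [markedProcess_eq_markSum]
  rw [markSum_eq_sum (B := Set.Icc 0 s) hf.toFinset (by simp),
    markSum_eq_sum (B := Set.Icc 0 s') hf'.toFinset (by simp)]
  refine sum_le_sum_of_subset fun k hk => ?_
  simp only [Set.Finite.mem_toFinset, Set.mem_ofPred_eq, Set.mem_Icc] at hk ⊢
  exact ⟨hk.1, hk.2.trans h⟩

/-- Only finitely many points lie in (s, s + 1], so the path is constant just to the right of s. -/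
lemma exists_rat_markedProcess_eq (hω : ∀ n : ℕ, {k | t k ω ∈ Set.Icc (0 : ℝ) n}.Finite)
    (s : ℝ) : ∃ q : ℚ, s < q ∧ markedProcess t a q ω = markedProcess t a s ω := by
  have hf := (finite_mem_Icc hω (s + 1)).image (fun k => t k ω)
  obtain ⟨r, hr, hsr⟩ : ∃ r, s < r ∧ ∀ k, t k ω ∈ Set.Icc 0 (s + 1) → s < t k ω → r ≤ t k ω := by
    have hev : ∀ᶠ r in 𝓝[>] s, ∀ y ∈ (fun k => t k ω) '' {k | t k ω ∈ Set.Icc 0 (s + 1)},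
        s < y → r ≤ y := by
      rw [Filter.eventually_all_finite hf]
      intro y _
      by_cases hy : s < y
      · filter_upwards [Ioo_mem_nhdsGT hy] with r hr _ using hr.2.le
      · exact .of_forall fun r h => absurd h hy
    obtain ⟨r, h1, h2⟩ := (hev.and self_mem_nhdsWithin).exists
    exact ⟨r, h2, fun k hk => h1 _ ⟨k, hk, rfl⟩⟩
  obtain ⟨q, hq, hqr⟩ := exists_rat_btwn (lt_min hr (lt_add_one s))
  refine ⟨q, hq, ?_⟩
  have hfs := finite_mem_Icc hω s
  rw [markedProcess_eq_markSum, markedProcess_eq_markSum,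
    markSum_eq_sum (B := Set.Icc 0 s) hfs.toFinset (by simp)]
  refine markSum_eq_sum _ (fun k => ?_) _
  simp only [Set.Finite.mem_toFinset, Set.mem_ofPred_eq, Set.mem_Icc]
  refine and_congr_right fun h0 => ⟨fun h => h.trans hq.le, fun h => ?_⟩
  by_contra hk
  push Not at hk
  have := hsr k ⟨h0, h.trans (hqr.le.trans (min_le_right _ _))⟩ hk
  linarith [hqr.trans_le (min_le_left r (s + 1))]

/-- The right limit at `s` of a nondecreasing path, computed from its values at rational times. -/
noncomputable def rightValue (s : ℝ) (x : ℝ → ℕ) : ℕ :=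
  ⌊(⨅ q : ℚ, if s < q then (x q : ℝ≥0∞) else ⊤).toNNReal⌋₊

/-- Plain evaluation (s, x) ↦ x s is not measurable for the product σ-algebra on ℝ → ℕ, in which the
independence of gaps and process is expressed. A countable infimum over rational times is. -/
lemma measurable_rightValue : Measurable fun y : ℝ × (ℝ → ℕ) => rightValue y.1 y.2 := by
  refine Nat.measurable_floor.comp (ENNReal.measurable_toNNReal.comp ?_)
  refine Measurable.iInf fun q => Measurable.ite ?_ ?_ measurable_const
  · exact measurableSet_lt measurable_fst measurable_const
  · exact measurable_from_top.comp ((measurable_pi_apply (q : ℝ)).comp measurable_snd)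

lemma rightValue_eq {x : ℝ → ℕ} (hx : Monotone x) {s : ℝ} (h : ∃ q : ℚ, s < q ∧ x q = x s) :
    rightValue s x = x s := by
  obtain ⟨q, hq, hqs⟩ := h
  have : (⨅ q : ℚ, if s < q then (x q : ℝ≥0∞) else ⊤) = (x s : ℝ≥0∞) := by
    refine le_antisymm ((iInf_le _ q).trans ?_) (le_iInf fun r => ?_)
    · rw [if_pos hq, hqs]
    · split_ifs with hr
      · exact_mod_cast hx hr.le
      · exact le_top
  rw [rightValue, this]
  simp

end MarkedPath

/-! ### The model, and measurability of the observed quantities. -/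

/-- A Poisson process of intensity `lam` with independent geometric marks, and independent
exponential inter-observation times. -/
structure ObservedPoints {Ω : Type*} [MeasurableSpace Ω] (P : Measure Ω) (lam mu : ℝ)
    (p : unitInterval) (t : ℕ → Ω → ℝ) (a : ℕ → Ω → ℕ) (Δ : ℕ → Ω → ℝ) : Prop where
  lam_pos : 0 < lam
  mu_pos : 0 < mu
  p_pos : 0 < p
  points : IsPoissonPoints lam t P
  measurable_mark : ∀ k, Measurable (a k)
  mark_law : ∀ k, HasLaw (a k) ((geometricMeasure p).map (fun n => n + 1)) P
  mark_indep : iIndepFun a P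
  indep_mark_points : IndepFun (fun ω k => a k ω) (fun ω k => t k ω) P
  measurable_gap : ∀ k, Measurable (Δ k)
  gap_zero : ∀ ω, Δ 0 ω = 0
  gap_law : ∀ k, 1 ≤ k → HasLaw (Δ k) (expMeasure mu) P
  gap_indep : iIndepFun Δ P
  indep_gap : IndepFun (fun ω k => Δ k ω) (fun ω s => markedProcess t a s ω) P

namespace ObservedPoints

variable {Ω : Type*} [MeasurableSpace Ω] {P : Measure Ω} {lam mu : ℝ}
  {p : unitInterval} {t : ℕ → Ω → ℝ} {a : ℕ → Ω → ℕ} {Δ : ℕ → Ω → ℝ}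

section

variable (h : ObservedPoints P lam mu p t a Δ)

include h

lemma ae_locallyFinite : ∀ᵐ ω ∂P, ∀ n : ℕ, {k | t k ω ∈ Set.Icc (0 : ℝ) n}.Finite :=
  ae_all_iff.2 fun _ => h.points.ae_finite measurableSet_Icc Set.Icc_subset_Ici_self (by simp)

lemma ae_gap_nonneg : ∀ᵐ ω ∂P, ∀ k, 0 ≤ Δ k ω := by
  refine ae_all_iff.2 fun k => ?_
  rcases Nat.eq_zero_or_pos k with rfl | hk
  · exact .of_forall fun ω => (h.gap_zero ω).ge
  · exact ((h.gap_law k hk).ae_iff (p := fun x => 0 ≤ x)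
      (measurableSet_setOfPred.1 measurableSet_Ici)).2 (ae_nonneg_of_exponential mu)

lemma measurable_obsTime (n : ℕ) : Measurable (obsTime Δ n) :=
  Finset.measurable_fun_sum _ fun k _ => h.measurable_gap k

lemma measurable_obsValue (n : ℕ) : Measurable (obsValue t a Δ n) := by
  refine measurable_tsum_nat fun k => Measurable.ite ?_ (h.measurable_mark k) measurable_const
  exact (measurableSet_le measurable_const (h.points.measurable k)).inter
    (measurableSet_le (h.points.measurable k) (h.measurable_obsTime n))

lemma measurable_path : Measurable fun ω s => markedProcess t a s ω := by
  refine measurable_pi_lambda _ fun s => ?_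
  refine measurable_tsum_nat fun k => Measurable.ite ?_ (h.measurable_mark k) measurable_const
  exact h.points.measurable k measurableSet_Icc

end

end ObservedPoints

/-! ### The Laplace exponent of the marked process. -/

/-- The Laplace exponent of the marked process at `z`. -/
noncomputable def markedExponent (lam p : ℝ) (z : ℂ) : ℂ := lam * (1 - geomGF p z)

lemma re_markedExponent_nonneg {lam p : ℝ} (hlam : 0 < lam) (hp : 0 < p) (hp1 : p ≤ 1) {z : ℂ}
    (hz : ‖z‖ ≤ 1) : 0 ≤ (markedExponent lam p z).re := by
  have h := (Complex.re_le_norm _).trans (norm_geomGF_le hp hp1 hz)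
  rw [markedExponent, Complex.re_ofReal_mul, Complex.sub_re, Complex.one_re]
  exact mul_nonneg hlam.le (by linarith)

lemma re_markedExponent_pos {lam p : ℝ} (hlam : 0 < lam) (hp : 0 < p) (hp1 : p ≤ 1) {z : ℂ}
    (hz : ‖z‖ < 1) : 0 < (markedExponent lam p z).re := by
  have h := (Complex.re_le_norm _).trans (norm_geomGF_le hp hp1 hz.le)
  rw [markedExponent, Complex.re_ofReal_mul, Complex.sub_re, Complex.one_re]
  exact mul_pos hlam (by linarith)

lemma markedExponent_one {lam p : ℝ} (hp : 0 < p) : markedExponent lam p 1 = 0 := by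
  have : (p : ℂ) ≠ 0 := by exact_mod_cast hp.ne'
  simp [markedExponent, geomGF, this]

lemma markedExponent_ofReal (lam p r : ℝ) :
    markedExponent lam p r = ((markedExponent lam p r).re : ℂ) := by
  have : markedExponent lam p r = ((lam * (1 - p * r / (1 - (1 - p) * r)) : ℝ) : ℂ) := by
    simp [markedExponent, geomGF]
  rw [this, Complex.ofReal_re]

lemma measurable_rightValue_sum (n : ℕ) : Measurable fun y : (ℕ → ℝ) × (ℝ → ℕ) =>
    rightValue (∑ k ∈ range (n + 1), y.1 k) y.2 := by
  have h1 : Measurable fun y : (ℕ → ℝ) × (ℝ → ℕ) => (∑ k ∈ range (n + 1), y.1 k, y.2) := by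
    fun_prop
  have h2 := measurable_rightValue.comp h1
  exact h2

lemma obsTime_succ {Ω : Type*} (Δ : ℕ → Ω → ℝ) (n : ℕ) (ω : Ω) :
    obsTime Δ (n + 1) ω = obsTime Δ n ω + Δ (n + 1) ω :=
  sum_range_succ _ _

/-! ### Joint transform of observation time, value and next increment at a fixed index. -/

namespace ObservedPoints

variable {Ω : Type*} [MeasurableSpace Ω] {P : Measure Ω} {lam mu : ℝ}
  {p : unitInterval} {t : ℕ → Ω → ℝ} {a : ℕ → Ω → ℕ} {Δ : ℕ → Ω → ℝ}

section

variable (h : ObservedPoints P lam mu p t a Δ)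

include h

lemma obsTime_eq_sum (n : ℕ) (ω : Ω) : obsTime Δ n ω = ∑ k ∈ range n, Δ (k + 1) ω := by
  rw [obsTime, sum_range_succ', h.gap_zero, add_zero]

lemma integral_pow_marked_increment [IsProbabilityMeasure P] {s s' : ℝ} (hs : 0 ≤ s)
    (hs' : s ≤ s') {z w : ℂ} (hz : ‖z‖ ≤ 1) (hw : ‖w‖ ≤ 1) :
    ∫ ω, z ^ markedProcess t a s ω * w ^ (markedProcess t a s' ω - markedProcess t a s ω) ∂P
      = Complex.exp (-markedExponent lam p z * s)
        * Complex.exp (-markedExponent lam p w * (s' - s : ℝ)) := by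
  have h1 := h.points.integral_pow_markSum h.lam_pos h.p_pos h.measurable_mark h.mark_law
    h.mark_indep h.indep_mark_points (B := Set.Icc 0 s) (C := Set.Ioc s s')
    (Set.disjoint_left.2 fun x hx hx' => not_lt.2 hx.2 hx'.1) measurableSet_Icc
    measurableSet_Ioc Set.Icc_subset_Ici_self (fun x hx => hs.trans hx.1.le) (by simp) (by simp)
    hz hw
  rw [Real.volume_real_Icc_of_le hs, Real.volume_real_Ioc_of_le hs', sub_zero] at h1
  rw [markedExponent, markedExponent, ← h1]
  refine integral_congr_ae ?_
  filter_upwards [h.ae_locallyFinite] with ω hω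
  rw [markedProcess_add_markSum hω hs hs', Nat.add_sub_cancel_left, markedProcess_eq_markSum]

/-- Freezing the gaps makes the observation times deterministic, so the formula at fixed times
applies. The factor f is general because both e^{-θτ_m} and τ_m itself are needed. -/
lemma integral_gap_mul_pow [IsProbabilityMeasure P] (m : ℕ) {f : (ℕ → ℝ) → ℂ}
    (hf : Measurable f) (hint : Integrable (fun ω => f fun k => Δ k ω) P) {z w : ℂ}
    (hz : ‖z‖ ≤ 1) (hw : ‖w‖ ≤ 1) :
    ∫ ω, (f fun k => Δ k ω) * (z ^ obsValue t a Δ m ω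
        * w ^ (obsValue t a Δ (m + 1) ω - obsValue t a Δ m ω)) ∂P
      = ∫ ω, (f fun k => Δ k ω) * (Complex.exp (-markedExponent lam p z * obsTime Δ m ω)
        * Complex.exp (-markedExponent lam p w * Δ (m + 1) ω)) ∂P := by
  obtain ⟨R, hR, hRm⟩ : ∃ R : ℕ → (ℕ → ℝ) × (ℝ → ℕ) → ℕ,
      (∀ n ω x, R n (fun k => Δ k ω, x) = rightValue (obsTime Δ n ω) x) ∧ ∀ n, Measurable (R n) :=
    ⟨_, fun n ω x => rfl, measurable_rightValue_sum⟩
  have hH : Measurable fun y : (ℕ → ℝ) × (ℝ → ℕ) =>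
      f y.1 * (z ^ R m y * w ^ (R (m + 1) y - R m y)) := (hf.comp measurable_fst).mul
    ((measurable_from_top.comp (hRm m)).mul
      (measurable_from_top.comp ((hRm (m + 1)).sub (hRm m))))
  have hgap : Measurable fun ω k => Δ k ω := measurable_pi_lambda _ h.measurable_gap
  have hHint : Integrable (fun ω => (fun y : (ℕ → ℝ) × (ℝ → ℕ) =>
      f y.1 * (z ^ R m y * w ^ (R (m + 1) y - R m y)))
      (fun k => Δ k ω, fun s => markedProcess t a s ω)) P := by
    refine hint.mono (hH.comp (hgap.prodMk h.measurable_path)).aestronglyMeasurable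
      (.of_forall fun ω => ?_)
    simp only
    rw [norm_mul]
    exact mul_le_of_le_one_right (norm_nonneg _) (norm_pow_mul_pow_le_one hz hw _ _)
  have hkey := integral_indepFun_eq_integral_integral h.indep_gap hgap h.measurable_path hH hHint
  simp only [hR] at hkey
  -- All s are covered by one almost sure event, so the identity may be used at random times.
  have hright : ∀ᵐ ω ∂P, ∀ s, rightValue s (fun s => markedProcess t a s ω)
      = markedProcess t a s ω := by
    filter_upwards [h.ae_locallyFinite] with ω hω s
    exact rightValue_eq (markedProcess_mono hω) (exists_rat_markedProcess_eq hω s)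
  refine Eq.trans (integral_congr_ae ?_) (hkey.trans (integral_congr_ae ?_))
  · filter_upwards [hright] with ω hω
    simp only [hω, obsValue]
  · filter_upwards [h.ae_gap_nonneg] with ω hω
    have h0 : 0 ≤ obsTime Δ m ω := sum_nonneg fun k _ => hω k
    have h1 := obsTime_succ Δ m ω
    have h2 := h.integral_pow_marked_increment h0 (s' := obsTime Δ (m + 1) ω)
      (by linarith [hω (m + 1)]) hz hw
    rw [show obsTime Δ (m + 1) ω - obsTime Δ m ω = Δ (m + 1) ω by linarith] at h2
    rw [← h2, ← integral_const_mul]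
    refine integral_congr_ae ?_
    filter_upwards [hright] with ω' hω'
    simp only [hω']

lemma integral_prod_exp_gap (n : ℕ) {s : ℕ → ℂ}
    (hs : ∀ k, 0 ≤ (s k).re) :
    ∫ ω, ∏ k ∈ range n, Complex.exp (-s k * Δ (k + 1) ω) ∂P
      = ∏ k ∈ range n, (mu / (mu + s k) : ℂ) := by
  have hinj : Function.Injective fun k : Fin n => (k : ℕ) + 1 := fun i j hij =>
    Fin.ext (Nat.succ_injective hij)
  have h1 := (h.gap_indep.precomp hinj).integral_fun_prod_comp
    (f := fun (k : Fin n) (x : ℝ) => Complex.exp (-s k * x))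
    (fun k => (h.measurable_gap _).aemeasurable)
    (fun k => (by fun_prop : Measurable _).aestronglyMeasurable)
  simp_rw [prod_range]
  rw [h1]
  refine prod_congr rfl fun k _ => ?_
  rw [← integral_exp_exponential h.mu_pos (hs k)]
  exact (h.gap_law (k + 1) (Nat.succ_pos _)).integral_comp
    (by fun_prop : Measurable fun x : ℝ => Complex.exp (-s k * x)).aestronglyMeasurable

lemma integral_exp_mul_pow [IsProbabilityMeasure P] (m : ℕ) {θ z w : ℂ} (hθ : 0 ≤ θ.re)
    (hz : ‖z‖ ≤ 1) (hw : ‖w‖ ≤ 1) :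
    ∫ ω, Complex.exp (-θ * obsTime Δ m ω) * (z ^ obsValue t a Δ m ω
        * w ^ (obsValue t a Δ (m + 1) ω - obsValue t a Δ m ω)) ∂P
      = (mu / (mu + (θ + markedExponent lam p z))) ^ m * (mu / (mu + markedExponent lam p w)) := by
  have hp0 : (0 : ℝ) < p := h.p_pos
  have hzr := re_markedExponent_nonneg h.lam_pos hp0 p.2.2 hz
  have hwr := re_markedExponent_nonneg h.lam_pos hp0 p.2.2 hw
  have hf : Measurable fun δ : ℕ → ℝ => Complex.exp (-θ * (∑ k ∈ range (m + 1), δ k : ℝ)) := by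
    fun_prop
  have hint : Integrable (fun ω => Complex.exp (-θ * obsTime Δ m ω)) P := by
    refine Integrable.of_bound (hf.comp (measurable_pi_lambda _ h.measurable_gap)
      ).aestronglyMeasurable 1 ?_
    filter_upwards [h.ae_gap_nonneg] with ω hω
    have h0 : 0 ≤ obsTime Δ m ω := sum_nonneg fun k _ => hω k
    rw [Complex.norm_exp, Real.exp_le_one_iff, Complex.re_mul_ofReal, Complex.neg_re]
    nlinarith
  have h1 := h.integral_gap_mul_pow m hf hint hz hw
  refine h1.trans ?_
  -- The m gaps making up τ_m carry θ + κ(z); the next gap carries κ(w).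
  have h2 := h.integral_prod_exp_gap (m + 1)
    (s := fun k => if k < m then θ + markedExponent lam p z else markedExponent lam p w)
    (fun k => by
      split_ifs
      · rw [Complex.add_re]
        linarith
      · exact hwr)
  simp_rw [prod_range_succ, lt_irrefl, if_false] at h2
  have e : ∀ g : ℂ → ℕ → ℂ, ∏ k ∈ range m, g (if k < m then θ + markedExponent lam p z
      else markedExponent lam p w) k = ∏ k ∈ range m, g (θ + markedExponent lam p z) k :=
    fun g => prod_congr rfl fun k hk => by rw [if_pos (mem_range.1 hk)]
  rw [e (fun c _ => mu / (mu + c)), prod_const, card_range] at h2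
  rw [← h2]
  congr 1 with ω
  rw [e (fun c k => Complex.exp (-c * Δ (k + 1) ω)), ← Complex.exp_sum, ← mul_sum,
    ← Complex.ofReal_sum, ← h.obsTime_eq_sum, ← mul_assoc, ← Complex.exp_add]
  change Complex.exp (-θ * obsTime Δ m ω + _) * _ = _
  ring_nf

end

end ObservedPoints

/-! ### From a joint generating function to the integral over the crossing event. -/

section Coefficients

variable {S : Type*} [MeasurableSpace S]

lemma hasSum_pow_mul_setIntegral {Q : Measure S} {N : S → ℕ} (hN : Measurable N) {f : S → ℂ}
    {z : ℂ} (hint : Integrable (fun q => z ^ N q * f q) Q) :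
    HasSum (fun k => z ^ k * ∫ q in {q | N q = k}, f q ∂Q) (∫ q, z ^ N q * f q ∂Q) := by
  have hm : ∀ k, MeasurableSet {q | N q = k} := fun k => hN (measurableSet_singleton k)
  have hU : (⋃ k, {q | N q = k}) = Set.univ := by ext; simp
  have h := hasSum_integral_iUnion (f := fun q => z ^ N q * f q) (μ := Q) hm
    (fun i j hij => Set.disjoint_left.2 fun q (hi : N q = i) (hj : N q = j) =>
      hij (hi.symm.trans hj)) hint.integrableOn
  rw [hU, setIntegral_univ] at h
  refine h.congr_fun fun k => ?_
  rw [← integral_const_mul]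
  exact setIntegral_congr_fun (hm k) fun q (hq : N q = k) => by simp only [hq]

lemma setIntegral_lt_eq_sum {Q : Measure S} {N : S → ℕ} (hN : Measurable N) {f : S → ℂ} (n : ℕ)
    (hf : Integrable f Q) :
    ∫ q in {q | N q < n}, f q ∂Q = ∑ i ∈ range n, ∫ q in {q | N q = i}, f q ∂Q := by
  have hU : {q | N q < n} = ⋃ i ∈ range n, {q | N q = i} := by ext; simp
  rw [hU, integral_biUnion_finset (s := fun i => {q | N q = i}) _
    (fun k _ => hN (measurableSet_singleton k))
    (fun i _ j _ hij => Set.disjoint_left.2 fun q (hi : N q = i) (hj : N q = j) =>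
      hij (hi.symm.trans hj)) (fun _ _ => hf.integrableOn)]

variable {Q : Measure S} {A X : S → ℕ} {W : S → ℂ} {x y u b C c : ℂ}

section

variable (hA : Measurable A) (hX : Measurable X)
  (hint : ∀ z w : ℂ, ‖z‖ < 1 → ‖w‖ ≤ 1 → Integrable (fun q => z ^ A q * (w ^ X q * W q)) Q)
  (heq : ∀ z w : ℂ, ‖z‖ < 1 → ‖w‖ ≤ 1 → ∫ q, z ^ A q * (w ^ X q * W q) ∂Q
    = C * ((1 - y * z) / (1 - x * z)) * (c * ((1 - b * w) / (1 - u * w))))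
  (hx : ‖x‖ ≤ 1) (hu : ‖u‖ ≤ 1)

-- On {A = k} the factor z^A is the constant z^k; taking z = 1/2, it can be divided out.
include hA hint in
lemma integrableOn_level (k : ℕ) {w : ℂ} (hw : ‖w‖ ≤ 1) :
    IntegrableOn (fun q => w ^ X q * W q) {q | A q = k} Q := by
  have h := ((hint (1 / 2) w (by norm_num) hw).integrableOn (s := {q | A q = k})).const_mul (2 ^ k)
  refine IntegrableOn.congr_fun h (fun q (hq : A q = k) => ?_) (hA (measurableSet_singleton k))
  simp only [hq, one_div, inv_pow]
  rw [← mul_assoc, mul_inv_cancel₀ (pow_ne_zero k two_ne_zero), one_mul]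

-- Comparison of coefficients in z at fixed w. The closed disc is kept for w because the value w =
-- v, possibly of modulus 1, is needed.
include hA hint heq hx in
lemma setIntegral_level (k : ℕ) {w : ℂ} (hw : ‖w‖ ≤ 1) :
    ∫ q in {q | A q = k}, w ^ X q * W q ∂Q
      = C * ratioCoeff x y k * (c * ((1 - b * w) / (1 - u * w))) := by
  refine eq_of_hasSum_pow_mul (s := fun z => ∫ q, z ^ A q * (w ^ X q * W q) ∂Q)
    (a := fun k => ∫ q in {q | A q = k}, w ^ X q * W q ∂Q)
    (b := fun k => C * ratioCoeff x y k * (c * ((1 - b * w) / (1 - u * w))))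
    (fun z hz => hasSum_pow_mul_setIntegral hA (hint z w hz hw)) (fun z hz => ?_) k
  have hxz : ‖x * z‖ < 1 := by
    rw [norm_mul]
    nlinarith [norm_nonneg x, norm_nonneg z]
  simp only [heq z w hz hw]
  refine (((hasSum_ratioCoeff x y hxz).mul_left C).mul_right
    (c * ((1 - b * w) / (1 - u * w)))).congr_fun fun k => ?_
  ring

include hA hX hint heq hx hu in
lemma setIntegral_level_level (k i : ℕ) :
    ∫ q in {q | X q = i}, W q ∂(Q.restrict {q | A q = k})
      = C * ratioCoeff x y k * (c * ratioCoeff u b i) := by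
  refine eq_of_hasSum_pow_mul (s := fun w => ∫ q in {q | A q = k}, w ^ X q * W q ∂Q)
    (a := fun i => ∫ q in {q | X q = i}, W q ∂(Q.restrict {q | A q = k}))
    (b := fun i => C * ratioCoeff x y k * (c * ratioCoeff u b i))
    (fun w hw => hasSum_pow_mul_setIntegral hX (integrableOn_level hA hint k hw.le))
    (fun w hw => ?_) i
  have huw : ‖u * w‖ < 1 := by
    rw [norm_mul]
    nlinarith [norm_nonneg u, norm_nonneg w]
  simp only [setIntegral_level hA hint heq hx k hw.le]
  rw [← mul_assoc]
  refine ((hasSum_ratioCoeff u b huw).mul_left (C * ratioCoeff x y k * c)).congr_fun fun i => ?_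
  ring

include hA hX hint heq hx hu in
/-- The integral of `v ^ (A + X) W` over the event that the level `M` is crossed between `A` and
`A + X`, from the joint generating function of `A` and `X`. -/
lemma setIntegral_crossing (M : ℕ) {v : ℂ} (hv : ‖v‖ ≤ 1) :
    ∫ q in {q | A q ≤ M ∧ M < A q + X q}, v ^ (A q + X q) * W q ∂Q
      = C * ∑ k ∈ range (M + 1), v ^ k * ratioCoeff x y k *
          (c * ((1 - b * v) / (1 - u * v))
            - c * ∑ i ∈ range (M + 1 - k), v ^ i * ratioCoeff u b i) := by
  have hAm : ∀ k, MeasurableSet {q | A q = k} := fun k => hA (measurableSet_singleton k)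
  have hXm : ∀ n, MeasurableSet {q | X q < n} := fun n => hX measurableSet_Iio
  have hset : {q | A q ≤ M ∧ M < A q + X q}
      = ⋃ k ∈ range (M + 1), {q | X q < M + 1 - k}ᶜ ∩ {q | A q = k} := by
    ext q
    simp only [Set.mem_ofPred_eq, Set.mem_iUnion, mem_range, Set.mem_inter_iff, Set.mem_compl_iff,
      exists_prop]
    constructor
    · rintro ⟨h1, h2⟩
      exact ⟨A q, by omega, by omega, rfl⟩
    · rintro ⟨k, h1, h2, h3⟩
      omega
  have hk : ∀ k, IntegrableOn (fun q => v ^ (A q + X q) * W q) {q | A q = k} Q := fun k => by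
    refine IntegrableOn.congr_fun ((integrableOn_level hA hint k hv).const_mul (v ^ k))
      (fun q (hq : A q = k) => ?_) (hAm k)
    simp only [← hq, pow_add, mul_assoc]
  rw [hset, integral_biUnion_finset _ (fun k _ => (hXm _).compl.inter (hAm k))
    (fun i _ j _ hij => Set.disjoint_left.2 fun q hi hj => hij (hi.2.symm.trans hj.2))
    (fun k _ => (hk k).mono_set Set.inter_subset_right), mul_sum]
  refine sum_congr rfl fun k _ => ?_
  have h1 : ∫ q in {q | X q < M + 1 - k}ᶜ ∩ {q | A q = k}, v ^ (A q + X q) * W q ∂Q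
      = v ^ k * ∫ q in {q | X q < M + 1 - k}ᶜ, v ^ X q * W q ∂(Q.restrict {q | A q = k}) := by
    rw [Measure.restrict_restrict (hXm _).compl, ← integral_const_mul]
    refine setIntegral_congr_fun ((hXm _).compl.inter (hAm k)) fun q hq => ?_
    have : A q = k := hq.2
    simp only [this, pow_add, mul_assoc]
  have hL := integrableOn_level hA hint k hv
  -- The tail {X ≥ M + 1 - k} is the total minus finitely many levels, so no infinite series in v
  -- appears.
  have h2 := integral_add_compl (hXm (M + 1 - k)) hL
  rw [setIntegral_level hA hint heq hx k hv, setIntegral_lt_eq_sum hX _ hL] at h2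
  have h3 : ∀ i, ∫ q in {q | X q = i}, v ^ X q * W q ∂(Q.restrict {q | A q = k})
      = v ^ i * (C * ratioCoeff x y k * (c * ratioCoeff u b i)) := fun i => by
    rw [← setIntegral_level_level hA hX hint heq hx hu k i, ← integral_const_mul]
    exact setIntegral_congr_fun (hX (measurableSet_singleton i)) fun q (hq : X q = i) => by
      simp only [hq]
  simp_rw [h3] at h2
  rw [h1, eq_sub_of_add_eq' h2]
  have h4 : ∑ i ∈ range (M + 1 - k), v ^ i * (C * ratioCoeff x y k * (c * ratioCoeff u b i))
      = C * ratioCoeff x y k * c * ∑ i ∈ range (M + 1 - k), v ^ i * ratioCoeff u b i := by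
    rw [mul_sum]
    exact sum_congr rfl fun i _ => by ring
  rw [h4]
  ring

end

end Coefficients

/-! ### Integration against counting measure times P. -/

section CountProd

variable {Ω : Type*} [MeasurableSpace Ω] {P : Measure Ω}

lemma ae_count_prod [SFinite P] {φ : ℕ × Ω → Prop} (h : ∀ᵐ ω ∂P, ∀ m, φ (m, ω)) :
    ∀ᵐ q ∂((Measure.count : Measure ℕ).prod P), φ q := by
  filter_upwards [Measure.quasiMeasurePreserving_snd.ae h] with q hq using hq q.1

lemma integrable_count_prod [SFinite P] {E : Type*} [NormedAddCommGroup E] {f : ℕ × Ω → E}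
    (hf : AEStronglyMeasurable f ((Measure.count : Measure ℕ).prod P))
    (h1 : ∀ m, Integrable (fun ω => f (m, ω)) P) (h2 : Summable fun m => ∫ ω, ‖f (m, ω)‖ ∂P) :
    Integrable f ((Measure.count : Measure ℕ).prod P) := by
  rw [integrable_prod_iff hf]
  refine ⟨.of_forall h1, ?_⟩
  rw [integrable_count_iff]
  exact h2.norm

lemma hasSum_integral_count_prod [SFinite P] {f : ℕ × Ω → ℂ}
    (hf : Integrable f ((Measure.count : Measure ℕ).prod P)) :
    HasSum (fun m => ∫ ω, f (m, ω) ∂P) (∫ q, f q ∂((Measure.count : Measure ℕ).prod P)) := by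
  have h := hf.integral_prod_left
  rw [integral_prod _ hf, integral_countable h]
  simp only [measureReal_def, Measure.count_singleton, ENNReal.toReal_one, one_smul]
  exact (integrable_count_iff.1 h).of_norm.hasSum

end CountProd

/-! ### Möbius form of the gap and renewal transforms. -/

section Algebra

/-- Keeps the poles of the Möbius factors out of the open unit disc. Multiplication by b shrinks the
imaginary part and does not increase the nonnegative real part. -/
lemma norm_ratio_le_one {b lam : ℝ} (hb : 0 ≤ b) (hb1 : b ≤ 1) (hlam : 0 < lam) {s : ℂ}
    (hs : 0 ≤ s.re) : ‖((b : ℂ) * s + lam) / (s + lam)‖ ≤ 1 := by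
  rw [norm_div]
  refine div_le_one_of_le₀ ?_ (norm_nonneg _)
  rw [← sq_le_sq₀ (norm_nonneg _) (norm_nonneg _), ← Complex.normSq_eq_norm_sq,
    ← Complex.normSq_eq_norm_sq, Complex.normSq_apply, Complex.normSq_apply]
  simp only [Complex.add_re, Complex.add_im, Complex.re_ofReal_mul, Complex.im_ofReal_mul,
    Complex.ofReal_re, Complex.ofReal_im, add_zero]
  have h1 : b * s.re ≤ s.re := mul_le_of_le_one_left hs hb1
  have h2 : 0 ≤ b * s.re := mul_nonneg hb hs
  have h3 : b * b ≤ 1 := mul_le_one₀ hb1 hb hb1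
  nlinarith [mul_le_mul_of_nonneg_right h3 (mul_self_nonneg s.im),
    mul_self_le_mul_self (by positivity : 0 ≤ b * s.re + lam) (by linarith : _ ≤ s.re + lam)]

lemma add_ofReal_ne_zero {s : ℂ} (hs : 0 ≤ s.re) {x : ℝ} (hx : 0 < x) : s + x ≠ 0 := fun h => by
  have := congrArg Complex.re h
  simp at this
  linarith

/-- Clearing the denominator of `geomGF` leaves a polynomial of degree at most one in z, whose
coefficient ratio is the factor in `transformF`. -/
lemma add_markedExponent_mul {p lam : ℝ} (hp : 0 < p) (hp1 : p ≤ 1) {s z : ℂ}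
    (hs : s + lam ≠ 0) (hz : ‖z‖ ≤ 1) :
    (s + markedExponent lam p z) * (1 - (1 - p : ℝ) * z)
      = (s + lam) * (1 - ((1 - p : ℝ) * s + lam) / (s + lam) * z) := by
  have h1 := one_sub_mul_ne_zero (q := 1 - p) (by linarith) (by linarith) hz
  have h2 : p * z / (1 - (1 - p : ℝ) * z) * (1 - (1 - p : ℝ) * z) = p * z := div_mul_cancel₀ _ h1
  have h3 : ((1 - p : ℝ) * s + lam) / (s + lam) * (s + lam) = (1 - p : ℝ) * s + lam :=
    div_mul_cancel₀ _ hs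
  rw [markedExponent, geomGF]
  push_cast at h2 h3 ⊢
  linear_combination z * h3 - lam * h2

lemma gap_transform_eq {p lam mu : ℝ} (hp : 0 < p) (hp1 : p ≤ 1) (hlam : 0 < lam) (hmu : 0 < mu)
    {w : ℂ} (hw : ‖w‖ ≤ 1) :
    (mu / (mu + markedExponent lam p w) : ℂ)
      = mu / (mu + lam) * ((1 - (1 - p : ℝ) * w)
        / (1 - ((1 - p : ℝ) * mu + lam) / (mu + lam) * w)) := by
  have h1 := one_sub_mul_ne_zero (q := 1 - p) (by linarith) (by linarith) hw
  have h2 : (mu : ℂ) + lam ≠ 0 := by exact_mod_cast (add_pos hmu hlam).ne'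
  have h3 : markedExponent lam p w + mu ≠ 0 :=
    add_ofReal_ne_zero (re_markedExponent_nonneg hlam hp hp1 hw) hmu
  have h4 := add_markedExponent_mul hp hp1 h2 hw
  have h5 : (1 : ℂ) - ((1 - p : ℝ) * mu + lam) / (mu + lam) * w ≠ 0 := fun h => by
    rw [h, mul_zero, add_comm] at h4
    exact mul_ne_zero h3 h1 h4
  rw [add_comm] at h3
  rw [div_mul_div_comm, div_eq_div_iff h3 (mul_ne_zero h2 h5), ← h4]
  ring

lemma renewal_transform_eq {p lam mu : ℝ} (hp : 0 < p) (hp1 : p ≤ 1) (hlam : 0 < lam)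
    (hmu : 0 < mu) {θ z : ℂ} (hθ : 0 ≤ θ.re) (hz : ‖z‖ < 1) :
    (1 - mu / (mu + (θ + markedExponent lam p z)))⁻¹
      = (mu + θ + lam) / (θ + lam) * ((1 - ((1 - p : ℝ) * (mu + θ) + lam) / (mu + θ + lam) * z)
        / (1 - ((1 - p : ℝ) * θ + lam) / (θ + lam) * z)) := by
  have h1 := one_sub_mul_ne_zero (q := 1 - p) (by linarith) (by linarith) hz.le
  have hk := re_markedExponent_pos hlam hp hp1 hz
  have h2 : θ + lam ≠ 0 := add_ofReal_ne_zero hθ hlam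
  have h3 : mu + θ + lam ≠ 0 := add_ofReal_ne_zero (by simp; linarith) hlam
  -- θ may be zero or purely imaginary, so the positive real part comes from ‖z‖ < 1.
  have h4 : θ + markedExponent lam p z ≠ 0 := fun h => by
    have := congrArg Complex.re h
    simp at this
    linarith
  have h5 : mu + (θ + markedExponent lam p z) ≠ 0 := by
    rw [add_comm]
    exact add_ofReal_ne_zero (by simp; linarith) hmu
  have h6 := add_markedExponent_mul hp hp1 h2 hz.le
  have h7 := add_markedExponent_mul hp hp1 h3 hz.le
  have h8 : (1 : ℂ) - ((1 - p : ℝ) * θ + lam) / (θ + lam) * z ≠ 0 := fun h => by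
    rw [h, mul_zero] at h6
    exact mul_ne_zero h4 h1 h6
  have h9 : 1 - mu / (mu + (θ + markedExponent lam p z))
      = (θ + markedExponent lam p z) / (mu + (θ + markedExponent lam p z)) := by
    field_simp
    ring
  rw [h9, inv_div, div_mul_div_comm, div_eq_div_iff h4 (mul_ne_zero h2 h8), ← h6, ← h7]
  ring

end Algebra

/-! ### The occupation measure and its generating function. -/

/-- The value at an observation, as a function of the index and the outcome. -/
noncomputable def levelAt {Ω : Type*} (t : ℕ → Ω → ℝ) (a : ℕ → Ω → ℕ) (Δ : ℕ → Ω → ℝ) (q : ℕ × Ω) : ℕ :=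
  obsValue t a Δ q.1 q.2

/-- The increment following an observation, as a function of the index and the outcome. -/
noncomputable def jumpAt {Ω : Type*} (t : ℕ → Ω → ℝ) (a : ℕ → Ω → ℕ) (Δ : ℕ → Ω → ℝ) (q : ℕ × Ω) : ℕ :=
  obsValue t a Δ (q.1 + 1) q.2 - obsValue t a Δ q.1 q.2

/-- The observation time, as a function of the index and the outcome. -/
noncomputable def timeAt {Ω : Type*} (Δ : ℕ → Ω → ℝ) (q : ℕ × Ω) : ℝ := obsTime Δ q.1 q.2

/-- Integration with respect to this measure sums expectations over the observation index. -/
noncomputable def occupation {Ω : Type*} [MeasurableSpace Ω] (P : Measure Ω) :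
    Measure (ℕ × Ω) := (Measure.count : Measure ℕ).prod P

instance {Ω : Type*} [MeasurableSpace Ω] (P : Measure Ω) [SFinite P] : SFinite (occupation P) :=
  inferInstanceAs (SFinite (Measure.prod _ P))

namespace ObservedPoints

variable {Ω : Type*} [MeasurableSpace Ω] {P : Measure Ω} {lam mu : ℝ}
  {p : unitInterval} {t : ℕ → Ω → ℝ} {a : ℕ → Ω → ℕ} {Δ : ℕ → Ω → ℝ}

section

variable (h : ObservedPoints P lam mu p t a Δ)

include h

lemma measurable_levelAt : Measurable (levelAt t a Δ) :=
  measurable_from_prod_countable_right fun m => h.measurable_obsValue m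

lemma measurable_jumpAt : Measurable (jumpAt t a Δ) :=
  measurable_from_prod_countable_right fun m =>
    (h.measurable_obsValue (m + 1)).sub (h.measurable_obsValue m)

lemma measurable_timeAt : Measurable (timeAt Δ) :=
  measurable_from_prod_countable_right fun m => h.measurable_obsTime m

lemma ae_obsTime_nonneg : ∀ᵐ ω ∂P, ∀ m, 0 ≤ obsTime Δ m ω := by
  filter_upwards [h.ae_gap_nonneg] with ω hω m using sum_nonneg fun k _ => hω k

lemma integrable_obsTime (m : ℕ) : Integrable (obsTime Δ m) P := by
  refine integrable_finsetSum _ fun k _ => ?_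
  rcases Nat.eq_zero_or_pos k with rfl | hk
  · exact (integrable_zero _ _ _).congr (.of_forall fun ω => (h.gap_zero ω).symm)
  · have hl := h.gap_law k hk
    have := integrable_id_exponential h.mu_pos
    rw [← hl.map_eq] at this
    exact (integrable_map_measure aestronglyMeasurable_id hl.aemeasurable).1 this

lemma markedExponent_re_pos {r : ℝ} (hr0 : 0 ≤ r) (hr1 : r < 1) :
    0 < (markedExponent lam p r).re :=
  re_markedExponent_pos h.lam_pos h.p_pos p.2.2 (by simpa [abs_of_nonneg hr0] using hr1)

variable [IsProbabilityMeasure P]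

lemma ae_timeAt_nonneg : ∀ᵐ q ∂(occupation P), 0 ≤ timeAt Δ q :=
  ae_count_prod h.ae_obsTime_nonneg

lemma integral_pow_obsValue (m : ℕ) {r : ℝ} (hr0 : 0 ≤ r) (hr1 : r ≤ 1) :
    ∫ ω, r ^ obsValue t a Δ m ω ∂P = (mu / (mu + (markedExponent lam p r).re)) ^ m := by
  have h1 := h.integral_exp_mul_pow m (θ := 0) (z := r) (w := 1) le_rfl
    (by simpa [abs_of_nonneg hr0] using hr1) (by simp)
  rw [markedExponent_one h.p_pos, markedExponent_ofReal] at h1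
  have hmu : (mu : ℂ) ≠ 0 := by exact_mod_cast h.mu_pos.ne'
  simp only [neg_zero, zero_mul, Complex.exp_zero, one_mul, one_pow, mul_one, zero_add, add_zero,
    div_self hmu] at h1
  have h2 : ∫ ω, (r : ℂ) ^ obsValue t a Δ m ω ∂P
      = ((∫ ω, r ^ obsValue t a Δ m ω ∂P : ℝ) : ℂ) := by
    rw [← integral_complex_ofReal]
    simp
  rw [h2] at h1
  exact_mod_cast h1

/-- E[r^{A_m}] decays geometrically in m, which compensates for the infinite mass of the occupation
measure. -/
lemma integrable_pow_levelAt {r : ℝ} (hr0 : 0 ≤ r) (hr1 : r < 1) :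
    Integrable (fun q => r ^ levelAt t a Δ q) (occupation P) := by
  have hm : ∀ m, Measurable fun ω => r ^ obsValue t a Δ m ω := fun m =>
    measurable_from_top.comp (h.measurable_obsValue m)
  refine integrable_count_prod
    (measurable_from_top.comp h.measurable_levelAt : Measurable _).aestronglyMeasurable
    (fun m => Integrable.of_bound (hm m).aestronglyMeasurable 1 (.of_forall fun ω => ?_)) ?_
  · simp only [levelAt, Real.norm_of_nonneg (pow_nonneg hr0 _)]
    exact pow_le_one₀ hr0 hr1.le
  · have hk := h.markedExponent_re_pos hr0 hr1
    have hmu := h.mu_pos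
    simp only [levelAt, Real.norm_of_nonneg (pow_nonneg hr0 _),
      h.integral_pow_obsValue _ hr0 hr1.le]
    exact summable_geometric_of_lt_one (by positivity) ((div_lt_one (by linarith)).2 (by linarith))

/-- Conditioning on the gaps turns r^{A_m} into e^{-κτ_m}, and τe^{-κτ} ≤ (2/κ)e^{-κτ/2}: half of
the exponent absorbs the factor τ, the other half still decays geometrically in m. -/
lemma integral_obsTime_mul_pow_le (m : ℕ) {r : ℝ} (hr0 : 0 ≤ r) (hr1 : r < 1) :
    ∫ ω, obsTime Δ m ω * r ^ obsValue t a Δ m ω ∂P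
      ≤ 2 / (markedExponent lam p r).re *
        (mu / (mu + (markedExponent lam p r).re / 2)) ^ m := by
  set κ := (markedExponent lam p r).re with hκ
  have hκ0 : 0 < κ := h.markedExponent_re_pos hr0 hr1
  have hmu : (mu : ℂ) ≠ 0 := by exact_mod_cast h.mu_pos.ne'
  have hsum : Measurable fun δ : ℕ → ℝ => ((∑ k ∈ range (m + 1), δ k : ℝ) : ℂ) := by fun_prop
  have h1 := h.integral_gap_mul_pow m hsum (h.integrable_obsTime m).ofReal (z := r) (w := 1)
    (by simpa [abs_of_nonneg hr0] using hr1.le) (by simp)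
  rw [markedExponent_one h.p_pos, markedExponent_ofReal, ← hκ] at h1
  change ∫ ω, (obsTime Δ m ω : ℂ) * _ ∂P = ∫ ω, (obsTime Δ m ω : ℂ) * _ ∂P at h1
  simp only [one_pow, mul_one, neg_zero, zero_mul, Complex.exp_zero] at h1
  have h2 : ∫ ω, obsTime Δ m ω * r ^ obsValue t a Δ m ω ∂P
      = ∫ ω, obsTime Δ m ω * Real.exp (-κ * obsTime Δ m ω) ∂P := by
    apply Complex.ofReal_injective
    rw [← integral_complex_ofReal, ← integral_complex_ofReal]
    push_cast
    exact h1
  have h3 := h.integral_exp_mul_pow m (θ := ((κ / 2 : ℝ) : ℂ)) (z := 1) (w := 1)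
    (by rw [Complex.ofReal_re]; positivity) (by simp) (by simp)
  rw [markedExponent_one h.p_pos] at h3
  simp only [one_pow, mul_one, add_zero, div_self hmu] at h3
  have h4 : ∫ ω, Real.exp (-(κ / 2) * obsTime Δ m ω) ∂P = (mu / (mu + κ / 2)) ^ m := by
    apply Complex.ofReal_injective
    rw [← integral_complex_ofReal]
    push_cast at h3 ⊢
    exact h3
  rw [h2, ← h4, ← integral_const_mul]
  have hexp : Integrable (fun ω => Real.exp (-(κ / 2) * obsTime Δ m ω)) P := by
    have hm := h.measurable_obsTime m
    refine Integrable.of_bound (by fun_prop : Measurable _).aestronglyMeasurable 1 ?_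
    filter_upwards [h.ae_obsTime_nonneg] with ω hω
    rw [Real.norm_of_nonneg (Real.exp_pos _).le, Real.exp_le_one_iff]
    nlinarith [hω m]
  refine integral_mono_of_nonneg ?_ (hexp.const_mul _) (.of_forall fun ω => ?_)
  · filter_upwards [h.ae_obsTime_nonneg] with ω hω using mul_nonneg (hω m) (Real.exp_pos _).le
  · have h5 := Real.add_one_le_exp (κ / 2 * obsTime Δ m ω)
    have h6 : Real.exp (-κ * obsTime Δ m ω)
        = Real.exp (-(κ / 2) * obsTime Δ m ω) * Real.exp (-(κ / 2) * obsTime Δ m ω) := by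
      rw [← Real.exp_add]
      ring_nf
    have h7 : Real.exp (κ / 2 * obsTime Δ m ω) * Real.exp (-(κ / 2) * obsTime Δ m ω) = 1 := by
      rw [← Real.exp_add]
      simp
    have h8 : obsTime Δ m ω ≤ 2 / κ * Real.exp (κ / 2 * obsTime Δ m ω) := by
      rw [div_mul_eq_mul_div, le_div_iff₀ hκ0]
      linarith
    calc obsTime Δ m ω * Real.exp (-κ * obsTime Δ m ω)
        ≤ 2 / κ * Real.exp (κ / 2 * obsTime Δ m ω) * Real.exp (-κ * obsTime Δ m ω) :=
          mul_le_mul_of_nonneg_right h8 (Real.exp_pos _).le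
      _ = 2 / κ * (Real.exp (κ / 2 * obsTime Δ m ω) * Real.exp (-(κ / 2) * obsTime Δ m ω))
          * Real.exp (-(κ / 2) * obsTime Δ m ω) := by rw [h6]; ring
      _ = _ := by rw [h7, mul_one]

lemma integrable_timeAt_mul_pow {r : ℝ} (hr0 : 0 ≤ r) (hr1 : r < 1) :
    Integrable (fun q => timeAt Δ q * r ^ levelAt t a Δ q) (occupation P) := by
  have hm : ∀ m, Measurable fun ω => r ^ obsValue t a Δ m ω := fun m =>
    measurable_from_top.comp (h.measurable_obsValue m)
  have hm' : Measurable fun q => r ^ levelAt t a Δ q :=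
    measurable_from_top.comp h.measurable_levelAt
  refine integrable_count_prod (h.measurable_timeAt.mul hm').aestronglyMeasurable
    (fun m => ?_) ?_
  · refine (h.integrable_obsTime m).mono
      ((h.measurable_obsTime m).mul (hm m)).aestronglyMeasurable (.of_forall fun ω => ?_)
    simp only [timeAt, levelAt]
    rw [norm_mul, Real.norm_of_nonneg (pow_nonneg hr0 _)]
    exact mul_le_of_le_one_right (norm_nonneg _) (pow_le_one₀ hr0 hr1.le)
  · have hk := h.markedExponent_re_pos hr0 hr1
    have hmu := h.mu_pos
    refine Summable.of_nonneg_of_le (fun m => integral_nonneg fun ω => norm_nonneg _)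
      (fun m => le_trans (le_of_eq (integral_congr_ae ?_))
        (h.integral_obsTime_mul_pow_le m hr0 hr1))
      ((summable_geometric_of_lt_one (by positivity)
        ((div_lt_one (by linarith)).2 (by linarith))).mul_left _)
    filter_upwards [h.ae_obsTime_nonneg] with ω hω
    exact Real.norm_of_nonneg (mul_nonneg (hω m) (pow_nonneg hr0 _))

lemma norm_exp_timeAt_le {θ : ℂ} (hθ : 0 ≤ θ.re) :
    ∀ᵐ q ∂(occupation P), ‖Complex.exp (-θ * timeAt Δ q)‖ ≤ 1 := by
  filter_upwards [h.ae_timeAt_nonneg] with q hq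
  rw [Complex.norm_exp, Real.exp_le_one_iff, Complex.re_mul_ofReal, Complex.neg_re]
  nlinarith

lemma integrable_occupation {θ z w : ℂ} (hθ : 0 ≤ θ.re) (hz : ‖z‖ < 1) (hw : ‖w‖ ≤ 1) :
    Integrable (fun q => z ^ levelAt t a Δ q * (w ^ jumpAt t a Δ q
      * Complex.exp (-θ * timeAt Δ q))) (occupation P) := by
  have hm := h.measurable_timeAt
  have h1 : Measurable fun q => z ^ levelAt t a Δ q :=
    measurable_from_top.comp h.measurable_levelAt
  have h2 : Measurable fun q => w ^ jumpAt t a Δ q :=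
    measurable_from_top.comp h.measurable_jumpAt
  refine (h.integrable_pow_levelAt (norm_nonneg z) hz).mono'
    (h1.mul (h2.mul (by fun_prop))).aestronglyMeasurable ?_
  filter_upwards [h.norm_exp_timeAt_le hθ] with q hq
  rw [norm_mul, norm_mul, norm_pow, norm_pow]
  refine mul_le_of_le_one_right (by positivity) (mul_le_one₀ ?_ (norm_nonneg _) hq)
  exact pow_le_one₀ (norm_nonneg _) hw

lemma integral_occupation {θ z w : ℂ} (hθ : 0 ≤ θ.re) (hz : ‖z‖ < 1) (hw : ‖w‖ ≤ 1) :
    ∫ q, z ^ levelAt t a Δ q * (w ^ jumpAt t a Δ q * Complex.exp (-θ * timeAt Δ q))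
        ∂(occupation P)
      = (mu + θ + lam) / (θ + lam)
          * ((1 - ((1 - p : ℝ) * (mu + θ) + lam) / (mu + θ + lam) * z)
            / (1 - ((1 - p : ℝ) * θ + lam) / (θ + lam) * z))
        * (mu / (mu + lam) * ((1 - (1 - p : ℝ) * w)
            / (1 - ((1 - p : ℝ) * mu + lam) / (mu + lam) * w))) := by
  have hp0 : (0 : ℝ) < p := h.p_pos
  have hsum := hasSum_integral_count_prod (h.integrable_occupation hθ hz hw)
  have h1 : ∀ m, ∫ ω, z ^ levelAt t a Δ (m, ω) * (w ^ jumpAt t a Δ (m, ω)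
      * Complex.exp (-θ * timeAt Δ (m, ω))) ∂P
      = (mu / (mu + (θ + markedExponent lam p z))) ^ m * (mu / (mu + markedExponent lam p w)) := by
    intro m
    rw [← h.integral_exp_mul_pow m hθ hz.le hw]
    congr 1 with ω
    simp only [levelAt, jumpAt, timeAt]
    ring
  simp_rw [h1] at hsum
  have hk := re_markedExponent_pos h.lam_pos hp0 p.2.2 hz
  have hnorm : ‖(mu / (mu + (θ + markedExponent lam p z)) : ℂ)‖ < 1 := by
    have h2 : mu < ‖(mu + (θ + markedExponent lam p z) : ℂ)‖ := by
      refine lt_of_lt_of_le ?_ (Complex.re_le_norm _)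
      simp only [Complex.add_re, Complex.ofReal_re]
      linarith
    rw [norm_div, Complex.norm_real, Real.norm_of_nonneg h.mu_pos.le]
    exact (div_lt_one (h.mu_pos.trans h2)).2 h2
  have h3 := (hasSum_geometric_of_norm_lt_one hnorm).mul_right
    (mu / (mu + markedExponent lam p w) : ℂ)
  rw [occupation, hsum.unique h3, renewal_transform_eq hp0 p.2.2 h.lam_pos h.mu_pos hθ hz,
    gap_transform_eq hp0 p.2.2 h.lam_pos h.mu_pos hw]

/-- The discounted transform of the value at the first observation above `M`, where the discount
is taken up to the preceding observation. -/
lemma setIntegral_crossing {θ v : ℂ} (hθ : 0 ≤ θ.re) (hv : ‖v‖ ≤ 1) (M : ℕ) :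
    ∫ q in {q | levelAt t a Δ q ≤ M ∧ M < levelAt t a Δ q + jumpAt t a Δ q},
        v ^ (levelAt t a Δ q + jumpAt t a Δ q) * Complex.exp (-θ * timeAt Δ q) ∂(occupation P)
      = (mu + θ + lam) / (θ + lam) * ∑ k ∈ range (M + 1),
          v ^ k * ratioCoeff (((1 - p : ℝ) * θ + lam) / (θ + lam))
            (((1 - p : ℝ) * (mu + θ) + lam) / (mu + θ + lam)) k *
          (mu / (mu + lam) * ((1 - (1 - p : ℝ) * v)
            / (1 - ((1 - p : ℝ) * mu + lam) / (mu + lam) * v))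
            - mu / (mu + lam) * ∑ i ∈ range (M + 1 - k),
              v ^ i * ratioCoeff (((1 - p : ℝ) * mu + lam) / (mu + lam)) (1 - p : ℝ) i) := by
  have hp0 : (0 : ℝ) < p := h.p_pos
  have hp1 : (p : ℝ) ≤ 1 := p.2.2
  exact ObservedPoisson.setIntegral_crossing h.measurable_levelAt h.measurable_jumpAt
    (fun z w hz hw => h.integrable_occupation hθ hz hw)
    (fun z w hz hw => h.integral_occupation hθ hz hw)
    (norm_ratio_le_one (by linarith) (by linarith) h.lam_pos hθ)
    (norm_ratio_le_one (by linarith) (by linarith) h.lam_pos h.mu_pos.le) M hv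

end

end ObservedPoints

lemma sum_crossing_eq (x y u b v c γ : ℂ) (M : ℕ) :
    ∑ k ∈ range (M + 1), v ^ k * ratioCoeff x y k *
        (γ - c * ∑ i ∈ range (M + 1 - k), v ^ i * ratioCoeff u b i)
      = γ * ((x * v) ^ M + (1 - y * v) * ∑ j ∈ range M, (x * v) ^ j)
        - c * (∑ j ∈ range (M + 1), (x * v) ^ j * ∑ i ∈ range (M + 1 - j), (u * v) ^ i
          - (y * v + b * v) * ∑ j ∈ range M, (x * v) ^ j * ∑ i ∈ range (M - j), (u * v) ^ i
          + b * v * (y * v) *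
            ∑ j ∈ range (M - 1), (x * v) ^ j * ∑ i ∈ range (M - 1 - j), (u * v) ^ i) := by
  have h1 := sum_range_ratioCoeff x y v (M + 1)
  have h2 := sum_mul_sum_ratioCoeff x y u b v (M + 1)
  rw [Nat.add_sub_cancel, sum_range_succ (fun i => (v * x) ^ i)] at h1
  rw [Nat.add_sub_cancel, show M + 1 - 2 = M - 1 by omega] at h2
  have h3 : ∑ k ∈ range (M + 1), v ^ k * ratioCoeff x y k *
        (γ - c * ∑ i ∈ range (M + 1 - k), v ^ i * ratioCoeff u b i)
      = γ * ∑ k ∈ range (M + 1), v ^ k * ratioCoeff x y k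
        - c * ∑ k ∈ range (M + 1), v ^ k * ratioCoeff x y k *
          ∑ i ∈ range (M + 1 - k), v ^ i * ratioCoeff u b i := by
    rw [mul_sum, mul_sum, ← sum_sub_distrib]
    exact sum_congr rfl fun k _ => by ring
  rw [h3, h1, h2, mul_comm v x, mul_comm v u, mul_comm v y, mul_comm v b]
  ring

/-! ### Decomposition of the exit variable over the observation index. -/

section Exit

variable {Ω : Type*} {t : ℕ → Ω → ℝ} {a : ℕ → Ω → ℕ} {Δ : ℕ → Ω → ℝ}

/-- `v ^ A` at the next observation if it is the first one above `M`, and `0` otherwise. -/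
noncomputable def crossingValue (t : ℕ → Ω → ℝ) (a : ℕ → Ω → ℕ) (Δ : ℕ → Ω → ℝ) (M : ℕ) (v : ℂ) :
    ℕ × Ω → ℂ :=
  {q | levelAt t a Δ q ≤ M ∧ M < levelAt t a Δ q + jumpAt t a Δ q}.indicator
    fun q => v ^ (levelAt t a Δ q + jumpAt t a Δ q)

/-- The contribution of an observation index to `exitVariable`. -/
noncomputable def exitKernel (t : ℕ → Ω → ℝ) (a : ℕ → Ω → ℕ) (Δ : ℕ → Ω → ℝ) (M : ℕ) (v : ℂ)
    (s : ℝ) (q : ℕ × Ω) : ℂ :=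
  (Set.Iio (timeAt Δ q)).indicator (fun _ => crossingValue t a Δ M v q) s

variable {M : ℕ} {v : ℂ}

/-- Crossing forces A ≤ M, so 1 ≤ 2^M · 2^{-A}; this gives integrability over all indices even when
‖v‖ = 1. -/
lemma norm_crossingValue_le (hv : ‖v‖ ≤ 1) (q : ℕ × Ω) :
    ‖crossingValue t a Δ M v q‖ ≤ 2 ^ M * (1 / 2 : ℝ) ^ levelAt t a Δ q := by
  rw [crossingValue]
  by_cases hq : q ∈ {q | levelAt t a Δ q ≤ M ∧ M < levelAt t a Δ q + jumpAt t a Δ q}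
  · rw [Set.indicator_of_mem hq, norm_pow]
    refine (pow_le_one₀ (norm_nonneg _) hv).trans ?_
    have h1 : (2 : ℝ) ^ levelAt t a Δ q ≤ 2 ^ M := pow_le_pow_right₀ one_le_two hq.1
    rw [one_div, inv_pow, ← div_eq_mul_inv, one_le_div (by positivity)]
    exact h1
  · rw [Set.indicator_of_notMem hq, norm_zero]
    positivity

lemma norm_exitKernel_le (s : ℝ) (q : ℕ × Ω) :
    ‖exitKernel t a Δ M v s q‖ ≤ ‖crossingValue t a Δ M v q‖ :=
  norm_indicator_le_norm_self _ _

lemma levelAt_crossing_iff {ω : Ω} (hmono : Monotone fun n => obsValue t a Δ n ω)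
    (hex : ∃ n, M < obsValue t a Δ n ω) (m : ℕ) :
    (levelAt t a Δ (m, ω) ≤ M ∧ M < levelAt t a Δ (m, ω) + jumpAt t a Δ (m, ω))
      ↔ m + 1 = exitIndex t a Δ M ω := by
  have hmm : levelAt t a Δ (m, ω) + jumpAt t a Δ (m, ω) = obsValue t a Δ (m + 1) ω :=
    Nat.add_sub_of_le (hmono (Nat.le_succ m))
  rw [hmm]
  have hmem : M < obsValue t a Δ (exitIndex t a Δ M ω) ω := Nat.sInf_mem hex
  constructor
  · rintro ⟨h1, h2⟩
    refine le_antisymm ?_ (Nat.sInf_le h2)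
    by_contra hlt
    have := hmono (show exitIndex t a Δ M ω ≤ m by omega)
    exact absurd (hmem.trans_le this) (not_lt.2 h1)
  · intro he
    rw [he]
    refine ⟨?_, hmem⟩
    by_contra hlt
    have : exitIndex t a Δ M ω ≤ m := Nat.sInf_le (not_le.1 hlt)
    omega

lemma exitKernel_of_ne {ω : Ω} (hmono : Monotone fun n => obsValue t a Δ n ω)
    (hex : ∃ n, M < obsValue t a Δ n ω) (s : ℝ) {m : ℕ}
    (hm : m ≠ exitIndex t a Δ M ω - 1) : exitKernel t a Δ M v s (m, ω) = 0 := by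
  have hc : crossingValue t a Δ M v (m, ω) = 0 :=
    Set.indicator_of_notMem (fun hmem => by
      have := (levelAt_crossing_iff hmono hex m).1 hmem
      omega) _
  simp [exitKernel, hc]

lemma exitKernel_exitIndex {ω : Ω} (hmono : Monotone fun n => obsValue t a Δ n ω)
    (h0 : obsValue t a Δ 0 ω = 0) (hex : ∃ n, M < obsValue t a Δ n ω) (s : ℝ) :
    exitKernel t a Δ M v s (exitIndex t a Δ M ω - 1, ω) = exitVariable t a Δ M v s ω := by
  have hmem : M < obsValue t a Δ (exitIndex t a Δ M ω) ω := Nat.sInf_mem hex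
  -- A_0 = 0 excludes exit at index 0, so ν - 1 is a genuine subtraction.
  have hne : exitIndex t a Δ M ω ≠ 0 := fun he => by
    rw [he, h0] at hmem
    omega
  obtain ⟨m, hm⟩ := Nat.exists_eq_succ_of_ne_zero hne
  have hcross := (levelAt_crossing_iff hmono hex m).2 hm.symm
  have hmm : levelAt t a Δ (m, ω) + jumpAt t a Δ (m, ω) = obsValue t a Δ (m + 1) ω :=
    Nat.add_sub_of_le (hmono (Nat.le_succ m))
  have hc : crossingValue t a Δ M v (m, ω) = v ^ obsValue t a Δ (m + 1) ω := by
    rw [← hmm]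
    exact Set.indicator_of_mem (s := {q | levelAt t a Δ q ≤ M ∧
      M < levelAt t a Δ q + jumpAt t a Δ q}) hcross _
  rw [exitVariable, prevObsTime, hm, Nat.succ_eq_add_one, Nat.add_sub_cancel,
    if_neg (Nat.succ_ne_zero m), exitKernel, hc, Set.indicator_apply]
  rfl

lemma exp_mul_exitKernel (θ : ℂ) (q : ℕ × Ω) (s : ℝ) :
    Complex.exp (-θ * s) * exitKernel t a Δ M v s q
      = (Set.Iio (timeAt Δ q)).indicator
        (fun s : ℝ => Complex.exp (-θ * s) * crossingValue t a Δ M v q) s := by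
  rw [exitKernel, Set.indicator_apply, Set.indicator_apply, mul_ite, mul_zero]

end Exit

/-! ### Almost sure exit, and Fubini for the Laplace transform in s. -/

namespace ObservedPoints

variable {Ω : Type*} [MeasurableSpace Ω] {P : Measure Ω} {lam mu : ℝ}
  {p : unitInterval} {t : ℕ → Ω → ℝ} {a : ℕ → Ω → ℕ} {Δ : ℕ → Ω → ℝ} {M : ℕ} {v θ : ℂ}

section

variable (h : ObservedPoints P lam mu p t a Δ)

include h

lemma measurable_crossingValue : Measurable (crossingValue t a Δ M v) := by
  have h1 := h.measurable_levelAt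
  have h2 := h.measurable_levelAt.add h.measurable_jumpAt
  refine Measurable.indicator (measurable_from_top.comp h2) ?_
  exact (h1 measurableSet_Iic).inter (h2 measurableSet_Ioi)

lemma ae_monotone_obsValue : ∀ᵐ ω ∂P, Monotone fun n => obsValue t a Δ n ω := by
  filter_upwards [h.ae_locallyFinite, h.ae_gap_nonneg] with ω h1 h2
  refine monotone_nat_of_le_succ fun n => markedProcess_mono h1 ?_
  rw [obsTime_succ]
  linarith [h2 (n + 1)]

lemma measurable_exitKernel :
    Measurable fun y : (ℕ × Ω) × ℝ => exitKernel t a Δ M v y.2 y.1 := by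
  have : (fun y : (ℕ × Ω) × ℝ => exitKernel t a Δ M v y.2 y.1)
      = {y : (ℕ × Ω) × ℝ | y.2 < timeAt Δ y.1}.indicator
        fun y => crossingValue t a Δ M v y.1 := rfl
  rw [this]
  exact (h.measurable_crossingValue.comp measurable_fst).indicator
    (measurableSet_lt measurable_snd (h.measurable_timeAt.comp measurable_fst))

variable [IsProbabilityMeasure P]

/-- Since 0^0 = 1, the identity E[0^{A_0}] = 1 says that A_0 vanishes almost surely. -/
lemma ae_obsValue_zero : ∀ᵐ ω ∂P, obsValue t a Δ 0 ω = 0 := by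
  have h1 := h.integral_pow_obsValue 0 le_rfl zero_le_one
  rw [pow_zero] at h1
  have hle : ∀ ω, (0 : ℝ) ^ obsValue t a Δ 0 ω ≤ 1 := fun ω => pow_le_one₀ le_rfl zero_le_one
  have hint : Integrable (fun ω => (0 : ℝ) ^ obsValue t a Δ 0 ω) P :=
    Integrable.of_bound (measurable_from_top.comp (h.measurable_obsValue 0) :
      Measurable _).aestronglyMeasurable 1 (.of_forall fun ω => by
        rw [Real.norm_of_nonneg (pow_nonneg le_rfl _)]
        exact hle ω)
  have h2 : ∫ ω, (1 - (0 : ℝ) ^ obsValue t a Δ 0 ω) ∂P = 0 := by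
    rw [integral_sub (integrable_const _) hint, h1]
    simp
  rw [integral_eq_zero_iff_of_nonneg (fun ω => sub_nonneg.2 (hle ω))
    ((integrable_const _).sub hint)] at h2
  filter_upwards [h2] with ω hω
  by_contra hne
  simp [zero_pow hne] at hω

/-- Integrability of 2^{-A} over the occupation measure makes Σ_n 2^{-A_n} finite almost surely, so
its terms drop below 2^{-M}. -/
lemma ae_exists_lt_obsValue (M : ℕ) : ∀ᵐ ω ∂P, ∃ n, M < obsValue t a Δ n ω := by
  have h1 := h.integrable_pow_levelAt (r := 1 / 2) (by norm_num) (by norm_num)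
  filter_upwards [h1.prod_left_ae] with ω hω
  have h2 := (integrable_count_iff.1 hω).tendsto_atTop_zero
  obtain ⟨n, hn⟩ := (h2.eventually (gt_mem_nhds (show (0 : ℝ) < (1 / 2) ^ M by positivity))).exists
  refine ⟨n, ?_⟩
  rw [Real.norm_of_nonneg (by positivity)] at hn
  exact (pow_lt_pow_iff_right_of_lt_one₀ (by norm_num) (by norm_num)).1 hn

lemma integrable_crossingValue_mul (hv : ‖v‖ ≤ 1) (hθ : 0 ≤ θ.re) :
    Integrable (fun q => crossingValue t a Δ M v q * Complex.exp (-θ * timeAt Δ q))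
      (occupation P) := by
  have hm := h.measurable_timeAt
  have h1 := (h.integrable_pow_levelAt (r := 1 / 2) (by norm_num) (by norm_num)).const_mul (2 ^ M)
  refine h1.mono' (h.measurable_crossingValue.mul (by fun_prop)).aestronglyMeasurable ?_
  filter_upwards [h.norm_exp_timeAt_le hθ] with q hq
  rw [norm_mul]
  exact (mul_le_of_le_one_right (norm_nonneg _) hq).trans (norm_crossingValue_le hv q)

lemma integrable_exitKernel (hv : ‖v‖ ≤ 1) (s : ℝ) :
    Integrable (exitKernel t a Δ M v s) (occupation P) := by
  have h1 := h.integrable_crossingValue_mul (M := M) hv (θ := 0) le_rfl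
  refine h1.mono (h.measurable_exitKernel.comp
    (measurable_id.prodMk measurable_const)).aestronglyMeasurable (.of_forall fun q => ?_)
  simpa using norm_exitKernel_le s q

lemma integral_count_exitKernel_ae (hv : ‖v‖ ≤ 1) (s : ℝ) :
    (fun ω => ∫ m, exitKernel t a Δ M v s (m, ω) ∂(Measure.count : Measure ℕ))
      =ᵐ[P] exitVariable t a Δ M v s := by
  filter_upwards [h.ae_monotone_obsValue, h.ae_obsValue_zero, h.ae_exists_lt_obsValue M,
    (h.integrable_exitKernel (M := M) hv s).prod_left_ae] with ω h1 h2 h3 h4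
  rw [integral_countable h4]
  simp only [measureReal_def, Measure.count_singleton, ENNReal.toReal_one, one_smul]
  rw [tsum_eq_single (exitIndex t a Δ M ω - 1) fun m hm => exitKernel_of_ne h1 h3 s hm]
  exact exitKernel_exitIndex h1 h2 h3 s

lemma integrable_exitVariable (hv : ‖v‖ ≤ 1) (s : ℝ) :
    Integrable (exitVariable t a Δ M v s) P :=
  (h.integrable_exitKernel hv s).integral_prod_right.congr (h.integral_count_exitKernel_ae hv s)

lemma integral_exitKernel (hv : ‖v‖ ≤ 1) (s : ℝ) :
    ∫ q, exitKernel t a Δ M v s q ∂(occupation P) = ∫ ω, exitVariable t a Δ M v s ω ∂P := by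
  rw [← integral_congr_ae (h.integral_count_exitKernel_ae hv s)]
  exact integral_prod_symm _ (h.integrable_exitKernel hv s)

/-- For Re θ = 0 the exponential gives no decay, so the s-integral is bounded by τ times the
crossing value; hence the need for `integrable_timeAt_mul_pow`. -/
lemma integrable_exp_mul_exitKernel (hv : ‖v‖ ≤ 1) (hθ : 0 ≤ θ.re) :
    Integrable (fun y : (ℕ × Ω) × ℝ => Complex.exp (-θ * y.2) * exitKernel t a Δ M v y.2 y.1)
      ((occupation P).prod (volume.restrict (Set.Ici 0))) := by
  have hmeas : Measurable fun y : (ℕ × Ω) × ℝ =>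
      Complex.exp (-θ * y.2) * exitKernel t a Δ M v y.2 y.1 :=
    (by fun_prop : Measurable fun y : (ℕ × Ω) × ℝ => Complex.exp (-θ * y.2)).mul
      h.measurable_exitKernel
  rw [integrable_prod_iff hmeas.aestronglyMeasurable]
  have hfin : ∀ q : ℕ × Ω, (volume.restrict (Set.Ici (0 : ℝ))) (Set.Iio (timeAt Δ q)) ≠ ∞ := by
    intro q
    rw [Measure.restrict_apply measurableSet_Iio, Set.inter_comm, Set.Ici_inter_Iio]
    simp
  have hbound : ∀ q : ℕ × Ω, ∀ᵐ s : ℝ ∂(volume.restrict (Set.Ici (0 : ℝ))),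
      ‖Complex.exp (-θ * s) * exitKernel t a Δ M v s q‖
        ≤ (Set.Iio (timeAt Δ q)).indicator (fun _ => ‖crossingValue t a Δ M v q‖) s := by
    intro q
    filter_upwards [ae_restrict_mem measurableSet_Ici] with s hs
    rw [exp_mul_exitKernel, norm_indicator_eq_indicator_norm]
    refine Set.indicator_le_indicator ?_
    rw [norm_mul]
    refine mul_le_of_le_one_left (norm_nonneg _) ?_
    rw [Complex.norm_exp, Real.exp_le_one_iff, Complex.re_mul_ofReal, Complex.neg_re]
    nlinarith [Set.mem_Ici.1 hs]
  have hind : ∀ q : ℕ × Ω, Integrable ((Set.Iio (timeAt Δ q)).indicator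
      fun _ : ℝ => ‖crossingValue t a Δ M v q‖) (volume.restrict (Set.Ici (0 : ℝ))) := fun q =>
    (integrable_indicator_iff measurableSet_Iio).2 (integrableOn_const (hfin q))
  refine ⟨.of_forall fun q => (hind q).mono'
    (hmeas.comp measurable_prodMk_left).aestronglyMeasurable (hbound q), ?_⟩
  refine ((h.integrable_timeAt_mul_pow (r := 1 / 2) (by norm_num)
    (by norm_num)).const_mul (2 ^ M)).mono'
    hmeas.norm.stronglyMeasurable.integral_prod_right'.aestronglyMeasurable ?_
  filter_upwards [h.ae_timeAt_nonneg] with q hq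
  rw [Real.norm_of_nonneg (integral_nonneg fun s => norm_nonneg _)]
  refine (integral_mono_of_nonneg (.of_forall fun s => norm_nonneg _) (hind q)
    (hbound q)).trans ?_
  rw [integral_indicator measurableSet_Iio, setIntegral_const, measureReal_def,
    Measure.restrict_apply measurableSet_Iio, Set.inter_comm, Set.Ici_inter_Iio, Real.volume_Ico,
    sub_zero, ENNReal.toReal_ofReal hq, smul_eq_mul, mul_left_comm]
  exact mul_le_mul_of_nonneg_left (norm_crossingValue_le hv q) hq

lemma integrableOn_exp_mul_integral (hv : ‖v‖ ≤ 1) (hθ : 0 ≤ θ.re) :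
    IntegrableOn (fun s : ℝ => Complex.exp (-θ * s) * ∫ ω, exitVariable t a Δ M v s ω ∂P)
      (Set.Ici 0) volume := by
  refine (h.integrable_exp_mul_exitKernel (M := M) hv hθ).integral_prod_right.congr
    (.of_forall fun s => ?_)
  simp only
  rw [integral_const_mul, h.integral_exitKernel hv]

/-- The exponent -0 is kept so that `integral_crossingValue_mul` applies to the first term at θ = 0.
-/
lemma integral_exp_mul_integral (hv : ‖v‖ ≤ 1) (hθ : 0 ≤ θ.re) (hθ0 : θ ≠ 0) :
    ∫ s in Set.Ici (0 : ℝ), Complex.exp (-θ * s) * ∫ ω, exitVariable t a Δ M v s ω ∂P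
      = 1 / θ * (∫ q, crossingValue t a Δ M v q * Complex.exp (-0 * timeAt Δ q) ∂(occupation P)
        - ∫ q, crossingValue t a Δ M v q * Complex.exp (-θ * timeAt Δ q) ∂(occupation P)) := by
  have h1 : ∀ s : ℝ, Complex.exp (-θ * s) * ∫ ω, exitVariable t a Δ M v s ω ∂P
      = ∫ q, Complex.exp (-θ * s) * exitKernel t a Δ M v s q ∂(occupation P) := fun s => by
    rw [integral_const_mul, h.integral_exitKernel hv]
  simp_rw [h1]
  have hint := h.integrable_exp_mul_exitKernel (M := M) hv hθ
  -- Fubini moves the s-integral inside, where it runs over [0, τ) and equals (1 - e^{-θτ})/θ times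
  -- the crossing value.
  rw [← integral_prod_symm _ hint, integral_prod _ hint,
    ← integral_sub (h.integrable_crossingValue_mul hv le_rfl)
      (h.integrable_crossingValue_mul hv hθ), ← integral_const_mul]
  refine integral_congr_ae ?_
  filter_upwards [h.ae_timeAt_nonneg] with q hq
  simp_rw [exp_mul_exitKernel]
  rw [integral_indicator measurableSet_Iio, Measure.restrict_restrict measurableSet_Iio,
    Set.inter_comm, Set.Ici_inter_Iio, integral_mul_const, integral_Ico_eq_integral_Ioc,
    ← intervalIntegral.integral_of_le hq, integral_exp_mul_complex (neg_ne_zero.2 hθ0)]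
  simp only [Complex.ofReal_zero, mul_zero, Complex.exp_zero, neg_zero, zero_mul, mul_one]
  field_simp
  ring

lemma integral_crossingValue_mul (hv : ‖v‖ ≤ 1) (hθ : 0 ≤ θ.re) :
    ∫ q, crossingValue t a Δ M v q * Complex.exp (-θ * timeAt Δ q) ∂(occupation P)
      = (mu + θ + lam) / (θ + lam) * ∑ k ∈ range (M + 1),
          v ^ k * ratioCoeff (((1 - p : ℝ) * θ + lam) / (θ + lam))
            (((1 - p : ℝ) * (mu + θ) + lam) / (mu + θ + lam)) k *
          (mu / (mu + lam) * ((1 - (1 - p : ℝ) * v)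
            / (1 - ((1 - p : ℝ) * mu + lam) / (mu + lam) * v))
            - mu / (mu + lam) * ∑ i ∈ range (M + 1 - k),
              v ^ i * ratioCoeff (((1 - p : ℝ) * mu + lam) / (mu + lam)) (1 - p : ℝ) i) := by
  rw [← h.setIntegral_crossing hθ hv M]
  have h1 := h.measurable_levelAt
  have h2 := h.measurable_levelAt.add h.measurable_jumpAt
  have hset : MeasurableSet
      {q | levelAt t a Δ q ≤ M ∧ M < levelAt t a Δ q + jumpAt t a Δ q} :=
    (h1 measurableSet_Iic).inter (h2 measurableSet_Ioi)
  rw [← integral_indicator hset]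
  congr 1 with q
  rw [crossingValue, Set.indicator_mul_left]

lemma jointTransform_zero (hv : ‖v‖ ≤ 1) :
    jointTransform P t a Δ v 0 = mu / (mu + lam) * ((1 - (1 - p : ℝ) * v)
      / (1 - ((1 - p : ℝ) * mu + lam) / (mu + lam) * v)) := by
  have h1 := h.integral_exp_mul_pow 0 (θ := 0) (z := 1) le_rfl (by simp) hv
  rw [← gap_transform_eq h.p_pos p.2.2 h.lam_pos h.mu_pos hv, jointTransform]
  simpa using h1

end

end ObservedPoints

end ObservedPoisson

/-! ### Assembly of the formula. -/

open ObservedPoisson in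
theorem mainTheorem7 {Ω : Type*} [MeasurableSpace Ω] (P : Measure Ω) [IsProbabilityMeasure P]
    (lam mu : ℝ) (hlam : 0 < lam) (hmu : 0 < mu)
    (p : unitInterval) (hp : 0 < p) (b : ℝ) (hb : b = 1 - (p : ℝ))
    (t : ℕ → Ω → ℝ) (a : ℕ → Ω → ℕ) (Δ : ℕ → Ω → ℝ)
    -- the underlying Poisson points
    (ht : IsPoissonPoints lam t P)
    -- independent marks, geometric on `{1, 2, …}` with parameter `p`, independent of the points
    (ha : ∀ k, Measurable (a k))
    (ha_law : ∀ k, HasLaw (a k) ((geometricMeasure p).map (fun n => n + 1)) P)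
    (ha_indep : iIndepFun a P)
    (hat : IndepFun (fun ω k => a k ω) (fun ω k => t k ω) P)
    -- `τ₀ = 0`, and independent exponential inter-observation times, independent of the process
    (hΔ : ∀ k, Measurable (Δ k))
    (hΔ_zero : ∀ ω, Δ 0 ω = 0)
    (hΔ_law : ∀ k, 1 ≤ k → HasLaw (Δ k) (expMeasure mu) P)
    (hΔ_indep : iIndepFun Δ P)
    (hΔA : IndepFun (fun ω k => Δ k ω) (fun ω s => markedProcess t a s ω) P)
    (M : ℕ) (v θ : ℂ) (hv : ‖v‖ ≤ 1) (hθ : 0 ≤ θ.re) (hθ0 : θ ≠ 0) :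
    let γ : ℂ := jointTransform P t a Δ v 0
    let F : ℂ → ℂ := fun x => transformF b lam x v
    -- the exit index is almost surely finite, and all the integrals below converge absolutely
    (∀ᵐ ω ∂P, ∃ n, M < obsValue t a Δ n ω) ∧
    (∀ s : ℝ, 0 ≤ s → Integrable (exitVariable t a Δ M v s) P) ∧
    IntegrableOn (fun s : ℝ => Complex.exp (-θ * (s : ℂ)) * ∫ ω, exitVariable t a Δ M v s ω ∂P)
      (Set.Ici 0) volume ∧
    γ = (mu / (mu + lam)) * ((1 - b * v) / (1 - F mu)) ∧
    ∫ s in Set.Ici (0 : ℝ), Complex.exp (-θ * (s : ℂ)) * ∫ ω, exitVariable t a Δ M v s ω ∂P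
      = (1 / θ) *
        (γ * ((mu + lam) / lam) *
            (v ^ M + (1 - F mu) * ∑ j ∈ Finset.range M, v ^ j)
          - γ * ((mu + θ + lam) / (θ + lam)) *
            (F θ ^ M + (1 - F (mu + θ)) * ∑ j ∈ Finset.range M, F θ ^ j)
          - (mu / lam) *
            (∑ j ∈ Finset.range (M + 1), v ^ j * ∑ i ∈ Finset.range (M + 1 - j), F mu ^ i
              - (F mu + b * v) *
                ∑ j ∈ Finset.range M, v ^ j * ∑ i ∈ Finset.range (M - j), F mu ^ i
              + b * v * F mu *
                ∑ j ∈ Finset.range (M - 1), v ^ j * ∑ i ∈ Finset.range (M - 1 - j), F mu ^ i)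
          + (mu / (mu + lam)) * ((mu + θ + lam) / (θ + lam)) *
            (∑ j ∈ Finset.range (M + 1), F θ ^ j * ∑ i ∈ Finset.range (M + 1 - j), F mu ^ i
              - (F (mu + θ) + b * v) *
                ∑ j ∈ Finset.range M, F θ ^ j * ∑ i ∈ Finset.range (M - j), F mu ^ i
              + b * v * F (mu + θ) *
                ∑ j ∈ Finset.range (M - 1),
                  F θ ^ j * ∑ i ∈ Finset.range (M - 1 - j), F mu ^ i)) := by
  have h : ObservedPoints P lam mu p t a Δ := ⟨hlam, hmu, hp, ht, ha, ha_law, ha_indep, hat, hΔ,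
    hΔ_zero, hΔ_law, hΔ_indep, hΔA⟩
  subst hb
  intro γ F
  have hγ : γ = (mu / (mu + lam)) * ((1 - (1 - p : ℝ) * v) / (1 - F mu)) := h.jointTransform_zero hv
  refine ⟨h.ae_exists_lt_obsValue M, fun s _ => h.integrable_exitVariable hv s,
    h.integrableOn_exp_mul_integral hv hθ, hγ, ?_⟩
  have hF : ∀ s : ℂ, ((1 - p : ℝ) * s + lam) / (s + lam) * v = F s := fun s => rfl
  -- The plain powers of v in the formula are the powers of F(θ, v) at θ = 0.
  have hF0 : F 0 = v := by
    have : (lam : ℂ) ≠ 0 := by exact_mod_cast hlam.ne'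
    simp [F, transformF, this]
  have hcoef : ((mu + lam) / lam * (mu / (mu + lam)) : ℂ) = mu / lam := by
    have : (mu + lam : ℂ) ≠ 0 := by exact_mod_cast (add_pos hmu hlam).ne'
    rw [mul_comm, div_mul_div_cancel₀ this]
  rw [h.integral_exp_mul_integral hv hθ hθ0, h.integral_crossingValue_mul hv le_rfl,
    h.integral_crossingValue_mul hv hθ, hF mu, ← hγ, sum_crossing_eq, sum_crossing_eq]
  simp only [hF, hF0]
  simp only [add_zero, zero_add]
  rw [← hcoef]
  ring
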